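/- Let $d\in\mathbb N_0$, let $\kappa:\mathbb R^d\to(0,\infty)$ be bounded and continuous with $\sup_{x}\sup_{|y|\le 1}\kappa(x)/\kappa(x-y)<\infty$, and put $\|u\|_\kappa:=\sup_x|u(x)|\kappa(x)$. Let $\mathrm C_\kappa$ be the space of continuous $f:\mathbb R^d\to\mathbb R$ with $\|f\|_\kappa<\infty$, and $\mathrm U_\kappa$ the set of upper semicontinuous $u:\mathbb R^d\to[-\infty,\infty)$ with $\|u^+\|_\kappa<\infty$. For functions $u_n$, let $(\Gamma\text{-}\limsup_n u_n)(x)$ be the supremum of $\limsup_n u_n(x_n)$ over all sequences $x_n\to x$. Write $u=\Gamma\text{-}\lim_n u_n$ if, for every $x$, $\limsup_n u_n(x_n)\le u(x)$ for all $x_n\to x$, and $u_n(x_n)\to u(x)$ for some $x_n\to x$. Let $\Gamma\text{-}\limsup_{s\to t}u_s$ be the supremum of $\Gamma\text{-}\limsup_n u_{s_n}$ over all sequences $s_n\to t$ in $[0,\infty)$, and let $u=\Gamma\text{-}\lim_{h\downarrow0}u_h$ mean that $u=\Gamma\text{-}\lim_n u_{h_n}$ for all sequences $h_n>0$ with $h_n\to0$.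 Let $S(t):\mathrm C_\kappa\to \mathrm U_\kappa$, $t\ge0$, be operators such that * each $S(t)$ is convex and monotone (pointwise) with $S(t)0=0$; * $S(t)g_n\downarrow S(t)g$ pointwise whenever $g_n,g\in \mathrm C_\kappa$ and $g_n\downarrow g$ pointwise; * $S(0)g=g$ and $\Gamma\text{-}\limsup_{s\to t}S(s)g\le S(t)g$ for all $t\ge 0$ and $g\in \mathrm C_\kappa$; * $\sup\{\|S(s)g\|_\kappa: s\in[0,t],\ g\in \mathrm C_\kappa,\ \|g\|_\kappa\le r\}<\infty$ for all $r,t\ge0$. Let $\mathcal L^S_+$ be the set of all $f\in \mathrm C_\kappa$ such that $S(t)f\in \mathrm C_\kappa$ and $S(s+t)f=S(s)S(t)f$ for all $s,t\ge0$, and such that there are $h_0>0$, $c\ge0$ with $\|(S(h)f-f)^+\|_\kappa\le ch$ for all $h\in[0,h_0]$. Let $D(A_\Gamma)$ be the set of all $f\in\mathcal L^S_+$ for which $A_\Gamma f:=\Gamma\text{-}\lim_{h\downarrow0}\frac{S(h)f-f}{h}$ exists in $\mathrm U_\kappa$. Let $\eta:\mathbb R^d\to[0,\infty)$ be infinitely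 differentiable with support in the closed unit ball and $\int\eta=1$, and let $\eta_n(x):=n^d\eta(nx)$ for $n\ge1$. Let $I\subset\mathbb N_0^d$ and let $H:\mathbb R^I\to\mathbb R$ be convex; if $I$ is infinite, assume in addition that $H$ is continuous for the product topology (for finite $I$ this is automatic). Let $f\in\mathcal L^S_+$ be such that, for every $\varepsilon>0$, there are $\delta,t_0>0$ with $$\|S(t)(\tau_xf)-\tau_xS(t)f\|_\kappa\le\varepsilon t\qquad\text{for all }t\in[0,t_0],\ |x|\le\delta,$$ where $(\tau_xu)(y):=u(x+y)$. With $f_n:=f*\eta_n\in C^\infty(\mathbb R^d)$, assume that 1. for every $\alpha\in I$, the distributional derivative $D^\alpha f$ is (given by) a locally integrable function; 2. $g:=H((D^\alpha f)_{\alpha\in I})$ is locally integrable; 3. $f_n\in D(A_\Gamma)$ and $(A_\Gamma f_n)(x)=H((D^\alpha f_n(x))_{\alpha\in I})$ for all $n\ge1$ and $x\in\mathbb R^d$. Let $X_g$ be the set of all $x\in\mathbb R^d$ for which $\tilde g(x):=\lim_{r\downarrow0}\frac1{|B(x,r)|}\int_{B(x,r)}g(y)\,dy$ exists in $\mathbb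 R$, and let $\overline g(x):=\limsup_{y\in X_g,\,y\to x}\tilde g(y)\in[-\infty,\infty]$ for $x\in\mathbb R^d$, where $y=x$ is allowed in the limit superior if $x\in X_g$. Then $f\in D(A_\Gamma)$ and $(A_\Gamma f)(x)=\overline g(x)$ for all $x\in\mathbb R^d$. -/

import Mathlib

open Filter Topology MeasureTheory
open scoped NNReal ENNReal ContDiff

noncomputable section

namespace GammaSemigroup

/-! ### Weighted function spaces -/

/-- `‖u‖_κ = sup_x |u x| κ x` for functions with extended real values. -/
def kappaNorm {X : Type*} (κ : X → ℝ) (u : X → EReal) : ℝ≥0∞ :=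
  ⨆ x, (u x).abs * ENNReal.ofReal (κ x)

/-- `C_κ`: continuous real functions with finite weighted norm. -/
def Ckappa {X : Type*} [TopologicalSpace X] (κ : X → ℝ) : Set (X → ℝ) :=
  {f | Continuous f ∧ kappaNorm κ (fun x => (f x : EReal)) < ⊤}

/-- `U_κ`: upper semicontinuous functions `X → [-∞, ∞)` whose positive part has finite
weighted norm. -/
def Ukappa {X : Type*} [TopologicalSpace X] (κ : X → ℝ) : Set (X → EReal) :=
  {u | UpperSemicontinuous u ∧ (∀ x, u x ≠ ⊤) ∧ kappaNorm κ (fun x => max (u x) 0) < ⊤}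

/-! ### Gamma-convergence -/

/-- The `Γ`-limit superior of a sequence of functions. -/
def gammaLimsup {X : Type*} [TopologicalSpace X] (u : ℕ → X → EReal) (x : X) : EReal :=
  ⨆ (y : ℕ → X) (_ : Tendsto y atTop (𝓝 x)), limsup (fun n => u n (y n)) atTop

/-- The `Γ`-limit superior `s → t` of a family indexed by `[0, ∞)`. -/
def gammaLimsupAt {X : Type*} [TopologicalSpace X] (v : ℝ≥0 → X → EReal) (t : ℝ≥0) (x : X) :
    EReal :=
  ⨆ (s : ℕ → ℝ≥0) (_ : Tendsto s atTop (𝓝 t)), gammaLimsup (fun n => v (s n)) x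

/-- `u = Γ-lim u_n`. -/
def IsGammaLim {X : Type*} [TopologicalSpace X] (u : ℕ → X → EReal) (v : X → EReal) : Prop :=
  ∀ x, (∀ y : ℕ → X, Tendsto y atTop (𝓝 x) → limsup (fun n => u n (y n)) atTop ≤ v x) ∧
    ∃ y : ℕ → X, Tendsto y atTop (𝓝 x) ∧ Tendsto (fun n => u n (y n)) atTop (𝓝 (v x))

theorem IsGammaLim.unique {X : Type*} [TopologicalSpace X] {u : ℕ → X → EReal}
    {v w : X → EReal} (hv : IsGammaLim u v) (hw : IsGammaLim u w) : v = w := by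
  funext x
  obtain ⟨y, hy, hyv⟩ := (hv x).2
  obtain ⟨z, hz, hzw⟩ := (hw x).2
  refine le_antisymm ?_ ?_
  · rw [← hyv.limsup_eq]; exact (hw x).1 y hy
  · rw [← hzw.limsup_eq]; exact (hv x).1 z hz

/-! ### Convex monotone families of operators -/

/-- The operators `S t : C_κ → U_κ` are convex and monotone with `S t 0 = 0`, continuous from
above, `Γ`-upper semicontinuous in time with `S 0 = id`, and locally uniformly bounded. The values
of `S t` outside `C_κ` are irrelevant. -/
structure IsConvexMonotoneFamily {X : Type*} [TopologicalSpace X] (κ : X → ℝ)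
    (S : ℝ≥0 → (X → ℝ) → X → EReal) : Prop where
  mapsTo : ∀ t, ∀ f ∈ Ckappa κ, S t f ∈ Ukappa κ
  convex : ∀ t, ∀ f ∈ Ckappa κ, ∀ g ∈ Ckappa κ, ∀ a b : ℝ, 0 < a → 0 < b → a + b = 1 →
    ∀ x, S t (a • f + b • g) x ≤ (a : EReal) * S t f x + (b : EReal) * S t g x
  mono : ∀ t, ∀ f ∈ Ckappa κ, ∀ g ∈ Ckappa κ, f ≤ g → S t f ≤ S t g
  map_zero : ∀ t x, S t 0 x = 0
  continuous_from_above : ∀ t, ∀ f : ℕ → X → ℝ, ∀ g : X → ℝ, (∀ n, f n ∈ Ckappa κ) →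
    g ∈ Ckappa κ → Antitone f → (∀ x, Tendsto (fun n => f n x) atTop (𝓝 (g x))) →
    Antitone (fun n => S t (f n)) ∧ ∀ x, Tendsto (fun n => S t (f n) x) atTop (𝓝 (S t g x))
  time_usc : ∀ t, ∀ f ∈ Ckappa κ, ∀ x, gammaLimsupAt (fun s => S s f) t x ≤ S t f x
  at_zero : ∀ f ∈ Ckappa κ, ∀ x, S 0 f x = (f x : EReal)
  bounded : ∀ r t : ℝ≥0, ∃ C : ℝ≥0, ∀ s ≤ t, ∀ f ∈ Ckappa κ,
    kappaNorm κ (fun x => (f x : EReal)) ≤ r → kappaNorm κ (S s f) ≤ C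

/-- The upper Lipschitz set `L^S_+`. -/
def upperLipschitzSet {X : Type*} [TopologicalSpace X] (κ : X → ℝ)
    (S : ℝ≥0 → (X → ℝ) → X → EReal) : Set (X → ℝ) :=
  {f | f ∈ Ckappa κ ∧
    (∀ t, ∃ g ∈ Ckappa κ, (∀ x, S t f x = (g x : EReal)) ∧ ∀ s, S (s + t) f = S s g) ∧
    ∃ h₀ : ℝ≥0, 0 < h₀ ∧ ∃ c : ℝ≥0, ∀ h ≤ h₀,
      kappaNorm κ (fun x => max (S h f x - (f x : EReal)) 0) ≤ c * h}

/-- The difference quotient `(S h f - f) / h`. -/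
def diffQuotient {X : Type*} (S : ℝ≥0 → (X → ℝ) → X → EReal) (f : X → ℝ) (h : ℝ≥0) (x : X) :
    EReal :=
  (S h f x - (f x : EReal)) / ((h : ℝ) : EReal)

/-- `u ∈ U_κ` is the `Γ`-limit of `(S h f - f) / h` as `h ↓ 0`. -/
def IsGammaDeriv {X : Type*} [TopologicalSpace X] (κ : X → ℝ)
    (S : ℝ≥0 → (X → ℝ) → X → EReal) (f : X → ℝ) (u : X → EReal) : Prop :=
  u ∈ Ukappa κ ∧ ∀ h : ℕ → ℝ≥0, (∀ n, 0 < h n) → Tendsto h atTop (𝓝 0) →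
    IsGammaLim (fun n => diffQuotient S f (h n)) u

theorem IsGammaDeriv.unique {X : Type*} [TopologicalSpace X] {κ : X → ℝ}
    {S : ℝ≥0 → (X → ℝ) → X → EReal} {f : X → ℝ} {u v : X → EReal}
    (hu : IsGammaDeriv κ S f u) (hv : IsGammaDeriv κ S f v) : u = v := by
  have h0 : Tendsto (fun n : ℕ => ((n : ℝ≥0) + 1)⁻¹) atTop (𝓝 0) := by
    have := tendsto_one_div_add_atTop_nhds_zero_nat (𝕜 := ℝ≥0)
    simpa [one_div] using this
  have hp : ∀ n : ℕ, 0 < ((n : ℝ≥0) + 1)⁻¹ := fun n => by positivity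
  exact (hu.2 _ hp h0).unique (hv.2 _ hp h0)

/-- The domain `D(A_Γ)` of the `Γ`-generator. -/
def gammaDomain {X : Type*} [TopologicalSpace X] (κ : X → ℝ)
    (S : ℝ≥0 → (X → ℝ) → X → EReal) : Set (X → ℝ) :=
  {f | f ∈ upperLipschitzSet κ S ∧ ∃ u, IsGammaDeriv κ S f u}

open Classical in
/-- The `Γ`-generator `A_Γ` (with the value `0` outside of its domain). -/
def gammaGenerator {X : Type*} [TopologicalSpace X] (κ : X → ℝ)
    (S : ℝ≥0 → (X → ℝ) → X → EReal) (f : X → ℝ) : X → EReal :=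
  if h : ∃ u, IsGammaDeriv κ S f u then h.choose else 0

theorem IsGammaDeriv.gammaGenerator_eq {X : Type*} [TopologicalSpace X] {κ : X → ℝ}
    {S : ℝ≥0 → (X → ℝ) → X → EReal} {f : X → ℝ} {u : X → EReal}
    (hu : IsGammaDeriv κ S f u) : gammaGenerator κ S f = u := by
  have h : ∃ u, IsGammaDeriv κ S f u := ⟨u, hu⟩
  rw [gammaGenerator, dif_pos h]
  exact h.choose_spec.unique hu

/-! ### Derivatives and mollification on Euclidean space -/

/-- The classical partial derivative in the `i`-th coordinate direction. -/
def pderiv {d : ℕ} (i : Fin d) (φ : EuclideanSpace ℝ (Fin d) → ℝ)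
    (x : EuclideanSpace ℝ (Fin d)) : ℝ :=
  fderiv ℝ φ x (EuclideanSpace.single i 1)

/-- The classical derivative `D^α = ∂_1^{α_1} ⋯ ∂_d^{α_d}`; only used for smooth functions. -/
def multiDeriv {d : ℕ} (α : Fin d → ℕ) (φ : EuclideanSpace ℝ (Fin d) → ℝ) :
    EuclideanSpace ℝ (Fin d) → ℝ :=
  (List.finRange d).foldr (fun i ψ => (pderiv i)^[α i] ψ) φ

/-- The distributional derivative `D^α f` is the regular distribution given by `F`. -/
def HasWeakDeriv {d : ℕ} (α : Fin d → ℕ) (f F : EuclideanSpace ℝ (Fin d) → ℝ) : Prop :=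
  LocallyIntegrable F volume ∧
    ∀ φ : EuclideanSpace ℝ (Fin d) → ℝ, ContDiff ℝ ∞ φ → HasCompactSupport φ →
      ∫ x, f x * multiDeriv α φ x = (-1 : ℝ) ^ (∑ i, α i) * ∫ x, F x * φ x

/-- The mollification `(f * η_n)(x) = ∫ f (x - y) η_n(y) dy` with `η_n(y) = n^d η (n y)`. -/
def mollify {d : ℕ} (η f : EuclideanSpace ℝ (Fin d) → ℝ) (n : ℕ)
    (x : EuclideanSpace ℝ (Fin d)) : ℝ :=
  ∫ y, f (x - y) * ((n : ℝ) ^ d * η ((n : ℝ) • y))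

/-! ### The ball-average representative and its upper semicontinuous hull -/

/-- The set `X_g` of all points at which the ball averages of `g` converge in `ℝ`. -/
def avgSet {d : ℕ} (g : EuclideanSpace ℝ (Fin d) → ℝ) : Set (EuclideanSpace ℝ (Fin d)) :=
  {x | ∃ l : ℝ, Tendsto (fun r : ℝ => ⨍ y in Metric.closedBall x r, g y) (𝓝[>] 0) (𝓝 l)}

/-- The representative `g̃ x = lim_{r ↓ 0} ⨍_{B(x,r)} g`, meaningful for `x ∈ X_g`. -/
def avgRep {d : ℕ} (g : EuclideanSpace ℝ (Fin d) → ℝ) (x : EuclideanSpace ℝ (Fin d)) : ℝ :=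
  limUnder (𝓝[>] 0) (fun r : ℝ => ⨍ y in Metric.closedBall x r, g y)

/-- The upper semicontinuous hull `limsup_{y ∈ X_g, y → x} g̃ y`, where `y = x` is allowed. -/
def uscHull {d : ℕ} (g : EuclideanSpace ℝ (Fin d) → ℝ) (x : EuclideanSpace ℝ (Fin d)) : EReal :=
  limsup (fun y => (avgRep g y : EReal)) (𝓝[avgSet g] x)

end GammaSemigroup

end

/-! Write `f_n = f * η_n`, `G_n = H((D^α f_n)_α) = A_Γ f_n`, and `ḡ` for the hull `uscHull g`. The
proof uses Jensen's inequality twice, in opposite directions. Since `D^α f_n = (D^α f) * η_n`,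
convexity of `H` gives `G_n ≤ g * η_n` (`jensen_pi`). Convexity of `S(t)` and approximate
translation invariance give `S(t) f_n ≤ (S(t) f) * η_n + ε t / κ` (`realValue_smear_le`,
`realValue_mollifier_le`).

Upper bound. If `ḡ(x₀) < a`, then `ḡ < a' < a` on a ball, `g ≤ ḡ` almost everywhere, and hence `G_n
≤ a'` on a smaller ball for large `n`. Let `w` be continuous, slightly above `a'` at `x₀` and at
least the common Lipschitz bound `C / κ` of the `f_n` outside the ball. Compactness and the Γ-limsup
inequality give `S(h) f_n ≤ f_n + h w` for `h` small depending on `n`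
(`exists_realValue_le_add_mul`). Telescoping with convexity turns this into `S(t) f_n - f_n ≤ t a`
near `x₀`, for times `t` that no longer depend on `n` (`realValue_sub_le_mul`). Letting `n → ∞`
needs lower semicontinuity of `S(t)`, which follows from convexity and continuity from above
(`realValue_le_of_approx`).

Lower bound. If `a < ḡ(x)`, then `g > a₁ > a` on a set of positive measure arbitrarily close to `x`.
By Lebesgue differentiation and continuity of `H`, `G_n → g` almost everywhere, so `G_n(z) > a₁` for
some nearby `z` and large `n`. Along a recovery sequence for `A_Γ f_n` at `z`, the second Jensen
inequality shows that a local average of `(S(h) f - f) / h` exceeds `a`; hence so does some value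
nearby (`eventually_exists_lt_of_smear`).

A diagonal selection combines both bounds into Γ-convergence (`isGammaDeriv_of_bounds`). -/

noncomputable section

namespace GammaSemigroup

/-! ### Real-valued reformulation -/

section Real

variable {X : Type*} [TopologicalSpace X] {κ : X → ℝ} {S : ℝ≥0 → (X → ℝ) → X → EReal}

/-- The real number `S t u x` for `u ∈ C_κ`. -/
def realValue {X : Type*} (S : ℝ≥0 → (X → ℝ) → X → EReal) (t : ℝ≥0) (u : X → ℝ) (x : X) : ℝ :=
  (S t u x).toReal

theorem le_kappaNorm {X : Type*} (κ : X → ℝ) (u : X → EReal) (x : X) :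
    (u x).abs * ENNReal.ofReal (κ x) ≤ kappaNorm κ u :=
  le_iSup (fun x => (u x).abs * ENNReal.ofReal (κ x)) x

theorem kappaNorm_coe_le_iff {X : Type*} {κ : X → ℝ} (hκ : ∀ x, 0 < κ x) {u : X → ℝ} {M : ℝ}
    (hM : 0 ≤ M) :
    kappaNorm κ (fun x => (u x : EReal)) ≤ ENNReal.ofReal M ↔ ∀ x, |u x| ≤ M / κ x := by
  simp only [kappaNorm, iSup_le_iff, EReal.abs_def]
  refine forall_congr' fun x => ?_
  rw [← ENNReal.ofReal_mul (abs_nonneg _), ENNReal.ofReal_le_ofReal_iff hM, le_div_iff₀ (hκ x)]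

theorem mem_Ckappa_iff (hκ : ∀ x, 0 < κ x) {u : X → ℝ} :
    u ∈ Ckappa κ ↔ Continuous u ∧ ∃ M, 0 ≤ M ∧ ∀ x, |u x| ≤ M / κ x := by
  refine and_congr_right fun _ => ⟨fun h => ?_, ?_⟩
  · refine ⟨(kappaNorm κ fun x => (u x : EReal)).toReal, ENNReal.toReal_nonneg, ?_⟩
    rw [← kappaNorm_coe_le_iff hκ ENNReal.toReal_nonneg, ENNReal.ofReal_toReal h.ne]
  · rintro ⟨M, hM, h⟩
    exact ((kappaNorm_coe_le_iff hκ hM).2 h).trans_lt ENNReal.ofReal_lt_top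

theorem Ckappa_add (hκ : ∀ x, 0 < κ x) {u v : X → ℝ} (hu : u ∈ Ckappa κ) (hv : v ∈ Ckappa κ) :
    u + v ∈ Ckappa κ := by
  rw [mem_Ckappa_iff hκ] at *
  obtain ⟨hu, M, hM, h⟩ := hu
  obtain ⟨hv, N, hN, h'⟩ := hv
  refine ⟨hu.add hv, M + N, by positivity, fun x => ?_⟩
  rw [add_div]
  exact (abs_add_le _ _).trans (add_le_add (h x) (h' x))

theorem Ckappa_smul (hκ : ∀ x, 0 < κ x) {u : X → ℝ} (a : ℝ) (hu : u ∈ Ckappa κ) :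
    a • u ∈ Ckappa κ := by
  rw [mem_Ckappa_iff hκ] at *
  obtain ⟨hu, M, hM, h⟩ := hu
  refine ⟨hu.const_smul a, |a| * M, by positivity, fun x => ?_⟩
  rw [Pi.smul_apply, smul_eq_mul, abs_mul, mul_div_assoc]
  exact mul_le_mul_of_nonneg_left (h x) (abs_nonneg a)

theorem Ckappa_neg (hκ : ∀ x, 0 < κ x) {u : X → ℝ} (hu : u ∈ Ckappa κ) : -u ∈ Ckappa κ := by
  simpa using Ckappa_smul hκ (-1) hu

theorem convex_Ckappa (hκ : ∀ x, 0 < κ x) : Convex ℝ (Ckappa κ) :=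
  fun _ hu _ hv a b _ _ _ => Ckappa_add hκ (Ckappa_smul hκ a hu) (Ckappa_smul hκ b hv)

namespace IsConvexMonotoneFamily

/-- The value `⊤` is excluded in `U_κ`; the value `⊥` would make the weighted norm infinite, against
the uniform bound on bounded sets. -/
theorem coe_realValue (hS : IsConvexMonotoneFamily κ S) (hκ : ∀ x, 0 < κ x) {u : X → ℝ}
    (hu : u ∈ Ckappa κ) (t : ℝ≥0) (x : X) : (realValue S t u x : EReal) = S t u x := by
  refine EReal.coe_toReal ((hS.mapsTo t u hu).2.1 x) fun hbot => ?_
  obtain ⟨C, hC⟩ := hS.bounded (kappaNorm κ fun x => (u x : EReal)).toNNReal t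
  have h := (le_kappaNorm κ (S t u) x).trans
    (hC t le_rfl u hu (ENNReal.coe_toNNReal hu.2.ne).ge)
  rw [hbot, EReal.abs_bot, ENNReal.top_mul (by simpa using hκ x)] at h
  exact absurd h (by simp)

theorem realValue_convex (hS : IsConvexMonotoneFamily κ S) (hκ : ∀ x, 0 < κ x) (t : ℝ≥0) (x : X) :
    ConvexOn ℝ (Ckappa κ) (fun u => realValue S t u x) := by
  rw [convexOn_iff_forall_pos]
  refine ⟨convex_Ckappa hκ, fun u hu v hv a b ha hb hab => ?_⟩
  have h := hS.convex t u hu v hv a b ha hb hab x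
  rw [← hS.coe_realValue hκ hu, ← hS.coe_realValue hκ hv,
    ← hS.coe_realValue hκ (convex_Ckappa hκ hu hv ha.le hb.le hab)] at h
  exact_mod_cast h

theorem realValue_mono (hS : IsConvexMonotoneFamily κ S) (hκ : ∀ x, 0 < κ x) {u v : X → ℝ}
    (hu : u ∈ Ckappa κ) (hv : v ∈ Ckappa κ) (huv : u ≤ v) (t : ℝ≥0) (x : X) :
    realValue S t u x ≤ realValue S t v x := by
  have h := hS.mono t u hu v hv huv x
  rw [← hS.coe_realValue hκ hu, ← hS.coe_realValue hκ hv] at h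
  exact EReal.coe_le_coe_iff.1 h

theorem realValue_zero (hS : IsConvexMonotoneFamily κ S) (t : ℝ≥0) (x : X) :
    realValue S t 0 x = 0 := by
  simp [realValue, hS.map_zero t x]

theorem realValue_at_zero (hS : IsConvexMonotoneFamily κ S) {u : X → ℝ} (hu : u ∈ Ckappa κ)
    (x : X) : realValue S 0 u x = u x := by
  simp [realValue, hS.at_zero u hu x]

theorem tendsto_realValue (hS : IsConvexMonotoneFamily κ S) (hκ : ∀ x, 0 < κ x) (t : ℝ≥0)
    {v : ℕ → X → ℝ} {u : X → ℝ} (hv : ∀ n, v n ∈ Ckappa κ) (hu : u ∈ Ckappa κ) (hanti : Antitone v)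
    (hlim : ∀ x, Tendsto (fun n => v n x) atTop (𝓝 (u x))) (x : X) :
    Tendsto (fun n => realValue S t (v n) x) atTop (𝓝 (realValue S t u x)) := by
  have h := (hS.continuous_from_above t v u hv hu hanti hlim).2 x
  rw [← hS.coe_realValue hκ hu] at h
  simp_rw [← hS.coe_realValue hκ (hv _)] at h
  exact_mod_cast h

/-- Γ-upper semicontinuity at time `0`, where `S 0` is the identity, gives joint upper
semicontinuity in time and space; first countability reduces it to sequences. -/
theorem eventually_realValue_lt [FirstCountableTopology X] (hS : IsConvexMonotoneFamily κ S)
    (hκ : ∀ x, 0 < κ x) {u : X → ℝ} (hu : u ∈ Ckappa κ) {x : X} {b : ℝ} (hb : u x < b) :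
    ∀ᶠ p : ℝ≥0 × X in 𝓝 (0, x), realValue S p.1 u p.2 < b := by
  by_contra hcon
  obtain ⟨p, hp, hpb⟩ := exists_seq_forall_of_frequently (not_eventually.1 hcon)
  rw [nhds_prod_eq, tendsto_prod_iff'] at hp
  have h1 : limsup (fun n => S (p n).1 u (p n).2) atTop ≤ S 0 u x := by
    refine le_trans ?_ (hS.time_usc 0 u hu x)
    refine le_trans ?_ (le_iSup₂ (f := fun (s : ℕ → ℝ≥0) (_ : Tendsto s atTop (𝓝 0)) =>
      gammaLimsup (fun n => S (s n) u) x) (fun n => (p n).1) hp.1)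
    exact le_iSup₂ (f := fun (y : ℕ → X) (_ : Tendsto y atTop (𝓝 x)) =>
      limsup (fun n => S (p n).1 u (y n)) atTop) (fun n => (p n).2) hp.2
  have h2 : (b : EReal) ≤ limsup (fun n => S (p n).1 u (p n).2) atTop := by
    refine le_limsup_of_frequently_le (Eventually.frequently (Eventually.of_forall fun n => ?_))
    rw [← hS.coe_realValue hκ hu]
    exact_mod_cast not_lt.1 (hpb n)
  have h3 := h2.trans h1
  rw [hS.at_zero u hu] at h3
  exact absurd hb (not_lt.2 (by exact_mod_cast h3))

/-- Zero is the midpoint of `u` and `-u`. This turns upper bounds on `S t (-u)` into the lower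
bounds on `S t u` that upper semicontinuity does not provide directly. -/
theorem neg_realValue_neg_le (hS : IsConvexMonotoneFamily κ S) (hκ : ∀ x, 0 < κ x) {u : X → ℝ}
    (hu : u ∈ Ckappa κ) (t : ℝ≥0) (x : X) : -realValue S t (-u) x ≤ realValue S t u x := by
  have h := (hS.realValue_convex hκ t x).2 hu (Ckappa_neg hκ hu)
    (by norm_num : (0 : ℝ) ≤ 1 / 2) (by norm_num : (0 : ℝ) ≤ 1 / 2) (by norm_num)
  simp only [smul_neg, add_neg_cancel, hS.realValue_zero, smul_eq_mul] at h
  linarith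

end IsConvexMonotoneFamily

end Real

/-! ### Weighted cutoffs and lower semicontinuity of `S t` -/

section Cutoff

variable {X : Type*} [NormedAddCommGroup X] {κ : X → ℝ} {S : ℝ≥0 → (X → ℝ) → X → EReal}

/-- A decreasing sequence in `C_κ` with limit `0` that dominates `M / κ` far away. -/
def weightCutoff (κ : X → ℝ) (M : ℝ) (m : ℕ) (x : X) : ℝ :=
  1 / ((m : ℝ) + 1) + M / κ x * min 1 (max (‖x‖ - m) 0)

theorem weightCutoff_nonneg (hκ : ∀ x, 0 < κ x) {M : ℝ} (hM : 0 ≤ M) (m : ℕ) (x : X) :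
    0 ≤ weightCutoff κ M m x := by
  have := hκ x
  have : 0 ≤ min 1 (max (‖x‖ - m) 0) := le_min zero_le_one (le_max_right _ _)
  unfold weightCutoff
  positivity

theorem Ckappa_of_bounded_div (hκ : ∀ x, 0 < κ x) (hbdd : ∃ C : ℝ, ∀ x, κ x ≤ C) {u : X → ℝ}
    (hu : Continuous u) {a M : ℝ} (ha : 0 ≤ a) (hM : 0 ≤ M) (h : ∀ x, |u x| ≤ a + M / κ x) :
    u ∈ Ckappa κ := by
  obtain ⟨C, hC⟩ := hbdd
  have hC0 : 0 ≤ C := (hκ 0).le.trans (hC 0)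
  refine (mem_Ckappa_iff hκ).2 ⟨hu, a * C + M, by positivity, fun x => (h x).trans ?_⟩
  rw [add_div]
  gcongr
  rw [le_div_iff₀ (hκ x)]
  exact mul_le_mul_of_nonneg_left (hC x) ha

theorem weightCutoff_mem (hκ : ∀ x, 0 < κ x) (hcont : Continuous κ)
    (hbdd : ∃ C : ℝ, ∀ x, κ x ≤ C) {M : ℝ} (hM : 0 ≤ M) (m : ℕ) :
    weightCutoff κ M m ∈ Ckappa κ := by
  refine Ckappa_of_bounded_div hκ hbdd (a := 1 / ((m : ℝ) + 1)) (M := M) ?_ (by positivity) hM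
    fun x => ?_
  · have : ∀ x, κ x ≠ 0 := fun x => (hκ x).ne'
    unfold weightCutoff
    fun_prop (disch := assumption)
  · rw [abs_of_nonneg (weightCutoff_nonneg hκ hM m x), weightCutoff]
    gcongr
    exact mul_le_of_le_one_right (div_nonneg hM (hκ x).le) (min_le_left _ _)

theorem weightCutoff_antitone (hκ : ∀ x, 0 < κ x) {M : ℝ} (hM : 0 ≤ M) :
    Antitone (weightCutoff κ M) := by
  intro m n hmn x
  have h1 : (m : ℝ) ≤ n := by exact_mod_cast hmn
  have := div_nonneg hM (hκ x).le
  unfold weightCutoff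
  gcongr

theorem tendsto_weightCutoff (M : ℝ) (x : X) :
    Tendsto (fun m => weightCutoff κ M m x) atTop (𝓝 0) := by
  refine (tendsto_one_div_add_atTop_nhds_zero_nat (𝕜 := ℝ)).congr' ?_
  filter_upwards [eventually_ge_atTop ⌈‖x‖⌉₊] with m hm
  have : ‖x‖ - m ≤ 0 := sub_nonpos.2 ((Nat.le_ceil _).trans (by exact_mod_cast hm))
  simp [weightCutoff, max_eq_right this]

theorem le_weightCutoff (hκ : ∀ x, 0 < κ x) {M : ℝ} (hM : 0 ≤ M) {m : ℕ} {a : ℝ} {x : X}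
    (h1 : a ≤ M / κ x) (h2 : ‖x‖ ≤ m + 1 → a ≤ 1 / ((m : ℝ) + 1)) : a ≤ weightCutoff κ M m x := by
  have := div_nonneg hM (hκ x).le
  unfold weightCutoff
  by_cases hx : ‖x‖ ≤ m + 1
  · refine (h2 hx).trans (le_add_of_nonneg_right (mul_nonneg this ?_))
    exact le_min zero_le_one (le_max_right _ _)
  · rw [min_eq_left (le_max_of_le_left (by linarith [not_le.1 hx])), mul_one]
    exact h1.trans (le_add_of_nonneg_left (by positivity))

/-- `S t` is lower semicontinuous along bounded locally uniform limits. -/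
theorem IsConvexMonotoneFamily.realValue_le_of_approx (hS : IsConvexMonotoneFamily κ S)
    (hκ : ∀ x, 0 < κ x) (hcont : Continuous κ) (hbdd : ∃ C : ℝ, ∀ x, κ x ≤ C) {M : ℝ} (hM : 0 ≤ M)
    {t : ℝ≥0} {u : X → ℝ} (hu : u ∈ Ckappa κ) {x : X} {b : ℝ}
    (h : ∀ m : ℕ, ∀ ε : ℝ, 0 < ε → ∃ w ∈ Ckappa κ, (∀ y, |w y - u y| ≤ weightCutoff κ M m y) ∧
      realValue S t w x ≤ b + ε) : realValue S t u x ≤ b := by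
  have hvm : ∀ m, u + (3 : ℝ) • weightCutoff κ M m ∈ Ckappa κ := fun m =>
    Ckappa_add hκ hu (Ckappa_smul hκ _ (weightCutoff_mem hκ hcont hbdd hM m))
  have key : ∀ m, realValue S t u x ≤ 1 / 2 * b +
      1 / 2 * realValue S t (u + (3 : ℝ) • weightCutoff κ M m) x := by
    intro m
    refine le_of_forall_pos_le_add fun ε hε => ?_
    obtain ⟨w, hw, hwu, hwb⟩ := h m ε hε
    have h1 := (hS.realValue_convex hκ t x).2 hw (hvm m)
      (by norm_num : (0 : ℝ) ≤ 1 / 2) (by norm_num : (0 : ℝ) ≤ 1 / 2) (by norm_num)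
    -- With `v` the cutoff, `w ≥ u - v` makes the midpoint of `w` and `u + 3 v` at least `u + v`.
    -- Any factor at least `1` would do in place of `3`.
    have h2 : realValue S t u x ≤ realValue S t ((1 / 2 : ℝ) • w +
        (1 / 2 : ℝ) • (u + (3 : ℝ) • weightCutoff κ M m)) x := by
      refine hS.realValue_mono hκ hu (convex_Ckappa hκ hw (hvm m) (by norm_num) (by norm_num)
        (by norm_num)) (fun y => ?_) t x
      have := weightCutoff_nonneg hκ hM m y
      have := (abs_le.1 (hwu y)).1
      simp only [Pi.add_apply, Pi.smul_apply, smul_eq_mul]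
      linarith
    simp only [smul_eq_mul] at h1
    linarith
  have hlim := hS.tendsto_realValue hκ t hvm hu
    (fun m n hmn y => by
      have := weightCutoff_antitone hκ hM hmn y
      simp only [Pi.add_apply, Pi.smul_apply, smul_eq_mul]
      linarith)
    (fun y => by simpa using (((tendsto_weightCutoff (κ := κ) M y).const_mul 3).const_add (u y))) x
  -- By continuity from above, the limit reads `S t u x ≤ b / 2 + S t u x / 2`, and the second term
  -- is absorbed.
  have := ge_of_tendsto' ((hlim.const_mul (1 / 2)).const_add (1 / 2 * b)) key
  linarith

end Cutoff

/-! ### Averages of translates -/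

section Smear

variable {d : ℕ}

local notation "𝔼" => EuclideanSpace ℝ (Fin d)

/-- The average `∫ u (x - y) dμ(y)` of translates of `u`. -/
def smear {d : ℕ} (μ : Measure (EuclideanSpace ℝ (Fin d))) (u : EuclideanSpace ℝ (Fin d) → ℝ)
    (x : EuclideanSpace ℝ (Fin d)) : ℝ :=
  ∫ y, u (x - y) ∂μ

theorem integrable_translate {μ : Measure 𝔼} [IsFiniteMeasure μ] {ρ : ℝ}
    (hμ : ∀ᵐ y ∂μ, y ∈ Metric.closedBall (0 : 𝔼) ρ) {u : 𝔼 → ℝ} (hu : Continuous u) (x : 𝔼) :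
    Integrable (fun y => u (x - y)) μ := by
  rw [← Measure.restrict_eq_self_of_ae_mem hμ]
  exact (hu.comp (continuous_const.sub continuous_id)).continuousOn.integrableOn_compact
    (isCompact_closedBall 0 ρ)

theorem smear_le {μ : Measure 𝔼} [IsProbabilityMeasure μ] {ρ : ℝ}
    (hμ : ∀ᵐ y ∂μ, y ∈ Metric.closedBall (0 : 𝔼) ρ) {u : 𝔼 → ℝ} (hu : Continuous u) {x : 𝔼} {b : ℝ}
    (h : ∀ y ∈ Metric.closedBall (0 : 𝔼) ρ, u (x - y) ≤ b) : smear μ u x ≤ b := by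
  have := integral_mono_ae (integrable_translate hμ hu x) (integrable_const b)
    (hμ.mono fun y hy => h y hy)
  simpa [smear] using this

theorem abs_smear_sub_le {μ : Measure 𝔼} [IsProbabilityMeasure μ] {ρ : ℝ}
    (hμ : ∀ᵐ y ∂μ, y ∈ Metric.closedBall (0 : 𝔼) ρ) {u : 𝔼 → ℝ} (hu : Continuous u) {x : 𝔼}
    {b c : ℝ} (h : ∀ y ∈ Metric.closedBall (0 : 𝔼) ρ, |u (x - y) - c| ≤ b) :
    |smear μ u x - c| ≤ b := by
  rw [abs_le]
  have h1 := smear_le hμ hu (b := c + b) fun y hy => by linarith [(abs_le.1 (h y hy)).2]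
  have h2 := smear_le hμ hu.neg (x := x) (b := b - c) fun y hy => by
    simp only [Pi.neg_apply]
    linarith [(abs_le.1 (h y hy)).1]
  have h3 : smear μ (-u) x = -smear μ u x := integral_neg _
  constructor <;> linarith

theorem exists_lt_of_lt_smear {μ : Measure 𝔼} [IsProbabilityMeasure μ] {ρ : ℝ}
    (hμ : ∀ᵐ y ∂μ, y ∈ Metric.closedBall (0 : 𝔼) ρ) {u : 𝔼 → ℝ} (hu : Continuous u) {x : 𝔼} {b : ℝ}
    (h : b < smear μ u x) : ∃ y ∈ Metric.closedBall (0 : 𝔼) ρ, b < u (x - y) := by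
  by_contra! hcon
  exact absurd h (not_lt.2 (smear_le hμ hu hcon))

/-- Reduces averages of translates to finite convex combinations, to which convexity of `S t`
applies directly. -/
theorem exists_simpleFunc_near {ρ : ℝ} (hρ : 0 ≤ ρ) {δ : ℝ} (hδ : 0 < δ) :
    ∃ s : SimpleFunc 𝔼 𝔼, (∀ y, s y ∈ Metric.closedBall (0 : 𝔼) ρ) ∧
      ∀ y ∈ Metric.closedBall (0 : 𝔼) ρ, dist (s y) y < δ := by
  set K := Metric.closedBall (0 : 𝔼) ρ with hK
  have h0 : (0 : 𝔼) ∈ K := by simpa [hK] using hρ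
  have : Nonempty K := ⟨⟨0, h0⟩⟩
  -- This is the sequence of values built into `SimpleFunc.approxOn`, with base point `0` at index
  -- `0`; compactness of the ball then bounds the index needed.
  let e : ℕ → 𝔼 := fun k => Nat.casesOn k 0 ((↑) ∘ TopologicalSpace.denseSeq K)
  have hcov : K ⊆ ⋃ k, Metric.ball (e k) δ := by
    intro y hy
    obtain ⟨k, hk⟩ := (TopologicalSpace.denseRange_denseSeq K).exists_dist_lt ⟨y, hy⟩ hδ
    exact Set.mem_iUnion.2 ⟨k + 1, hk⟩
  obtain ⟨T, hT⟩ := (isCompact_closedBall (0 : 𝔼) ρ).elim_finite_subcover _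
    (fun k => Metric.isOpen_ball) hcov
  refine ⟨SimpleFunc.approxOn id measurable_id K 0 h0 (T.sup id),
    fun y => SimpleFunc.approxOn_mem _ _ _ _, fun y hy => ?_⟩
  obtain ⟨k, hk, hky⟩ : ∃ k ∈ T, y ∈ Metric.ball (e k) δ := by simpa using hT hy
  have h1 := SimpleFunc.edist_nearestPt_le e y (Finset.le_sup (f := id) hk)
  rw [edist_dist, edist_dist, ENNReal.ofReal_le_ofReal_iff dist_nonneg] at h1
  refine lt_of_le_of_lt h1 ?_
  rw [dist_comm]
  exact hky

theorem integral_comp_simpleFunc {μ : Measure 𝔼} [IsFiniteMeasure μ] (s : SimpleFunc 𝔼 𝔼)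
    (φ : 𝔼 → ℝ) : ∫ y, φ (s y) ∂μ = ∑ b ∈ s.range, μ.real (s ⁻¹' {b}) * φ b := by
  have h : ∀ y, φ (s y) = ∑ b ∈ s.range, (s ⁻¹' {b}).indicator (fun _ => φ b) y := by
    intro y
    rw [Finset.sum_eq_single (s y)]
    · simp
    · intro b _ hb
      simp [Set.indicator, hb.symm]
    · simp
  simp_rw [h]
  rw [integral_finsetSum]
  · refine Finset.sum_congr rfl fun b _ => ?_
    rw [integral_indicator_const _ (s.measurableSet_fiber b), smul_eq_mul]
  · intro b _
    exact (integrable_const _).indicator (s.measurableSet_fiber b)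

end Smear

/-! ### Jensen's inequality for `S t` and averages of translates -/

section Shift

variable {d : ℕ} {κ : EuclideanSpace ℝ (Fin d) → ℝ}
  {S : ℝ≥0 → (EuclideanSpace ℝ (Fin d) → ℝ) → EuclideanSpace ℝ (Fin d) → EReal}

local notation "𝔼" => EuclideanSpace ℝ (Fin d)

theorem div_weight_translate_le (hκ : ∀ x, 0 < κ x) {c : ℝ}
    (hc : ∀ x y : 𝔼, ‖y‖ ≤ 1 → κ x / κ (x - y) ≤ c) {M : ℝ} (hM : 0 ≤ M) (x : 𝔼) {y : 𝔼}
    (hy : ‖y‖ ≤ 1) : M / κ (x - y) ≤ c * M / κ x := by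
  have h1 := hκ x
  have h2 := hκ (x - y)
  have := (div_le_iff₀ h2).1 (hc x y hy)
  rw [div_le_div_iff₀ h2 h1]
  nlinarith

theorem Ckappa_translate (hκ : ∀ x, 0 < κ x) {c : ℝ}
    (hc : ∀ x y : 𝔼, ‖y‖ ≤ 1 → κ x / κ (x - y) ≤ c) {u : 𝔼 → ℝ} (hu : u ∈ Ckappa κ) {y : 𝔼}
    (hy : ‖y‖ ≤ 1) : (fun z => u (z - y)) ∈ Ckappa κ := by
  rw [mem_Ckappa_iff hκ] at *
  obtain ⟨hu, M, hM, h⟩ := hu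
  have hc0 : 0 ≤ c := (div_pos (hκ y) (hκ _)).le.trans (hc y y hy)
  exact ⟨hu.comp (continuous_id.sub continuous_const), c * M, by positivity,
    fun x => (h _).trans (div_weight_translate_le hκ hc hM x hy)⟩

/-- Jensen's inequality for averages of translates. -/
theorem IsConvexMonotoneFamily.realValue_smear_le (hS : IsConvexMonotoneFamily κ S)
    (hκ : ∀ x, 0 < κ x) (hcont : Continuous κ) (hbdd : ∃ C : ℝ, ∀ x, κ x ≤ C) {c : ℝ}
    (hc : ∀ x y : 𝔼, ‖y‖ ≤ 1 → κ x / κ (x - y) ≤ c) {μ : Measure 𝔼} [IsProbabilityMeasure μ]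
    {ρ : ℝ} (hρ : 0 ≤ ρ) (hρ1 : ρ ≤ 1) (hμ : ∀ᵐ y ∂μ, y ∈ Metric.closedBall (0 : 𝔼) ρ)
    {u : 𝔼 → ℝ} (hu : u ∈ Ckappa κ) (hμu : smear μ u ∈ Ckappa κ) {t : ℝ≥0} {U : 𝔼 → ℝ}
    (hU : Continuous U) {e : ℝ} {x : 𝔼}
    (h : ∀ y ∈ Metric.closedBall (0 : 𝔼) ρ,
      realValue S t (fun z => u (z - y)) x ≤ U (x - y) + e) :
    realValue S t (smear μ u) x ≤ smear μ U x + e := by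
  obtain ⟨M, hM, huM⟩ := ((mem_Ckappa_iff hκ).1 hu).2
  have huc := hu.1
  have hc0 : 0 ≤ c := (div_pos (hκ 0) (hκ _)).le.trans (hc 0 0 (by simp))
  have hb : ∀ y ∈ Metric.closedBall (0 : 𝔼) ρ, ‖y‖ ≤ 1 := fun y hy =>
    (mem_closedBall_zero_iff.1 hy).trans hρ1
  have hub : ∀ z, ∀ y ∈ Metric.closedBall (0 : 𝔼) ρ, |u (z - y)| ≤ c * M / κ z := fun z y hy =>
    (huM _).trans (div_weight_translate_le hκ hc hM z (hb y hy))
  -- Both the average and its discretization are bounded by `c M / κ`, so twice this bounds their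
  -- difference far away.
  refine hS.realValue_le_of_approx hκ hcont hbdd (M := 2 * (c * M)) (by positivity) hμu
    fun m ε hε => ?_
  have hball : ∀ (z : 𝔼) (R : ℝ), ‖z‖ ≤ R → ∀ y ∈ Metric.closedBall (0 : 𝔼) ρ,
      z - y ∈ Metric.closedBall (0 : 𝔼) (R + 1) := fun z R hz y hy => by
    rw [mem_closedBall_zero_iff]
    linarith [norm_sub_le z y, hb y hy]
  -- `δ₁` makes the discretization error of `u` at most `1 / (m + 1)` where the cutoff is not yet
  -- full; `δ₂` makes that of `U` at the point `x` at most `ε`.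
  obtain ⟨δ₁, hδ₁, h₁⟩ := Metric.uniformContinuousOn_iff.1
    ((isCompact_closedBall (0 : 𝔼) (m + 1 + 1)).uniformContinuousOn_of_continuous
      huc.continuousOn) (1 / ((m : ℝ) + 1)) (by positivity)
  obtain ⟨δ₂, hδ₂, h₂⟩ := Metric.uniformContinuousOn_iff.1
    ((isCompact_closedBall (0 : 𝔼) (‖x‖ + 1)).uniformContinuousOn_of_continuous
      hU.continuousOn) ε hε
  obtain ⟨s, hsK, hs⟩ := exists_simpleFunc_near (d := d) hρ (lt_min hδ₁ hδ₂)
  have hsr : ∀ b ∈ s.range, b ∈ Metric.closedBall (0 : 𝔼) ρ := by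
    intro b hb
    obtain ⟨y, rfl⟩ := SimpleFunc.mem_range.1 hb
    exact hsK y
  have hwt : ∑ b ∈ s.range, μ.real (s ⁻¹' {b}) = 1 := by
    simpa using (integral_comp_simpleFunc (μ := μ) s (fun _ => 1)).symm
  have hw0 : ∀ b ∈ s.range, 0 ≤ μ.real (s ⁻¹' {b}) := fun _ _ => measureReal_nonneg
  have hpm : ∀ b ∈ s.range, (fun z => u (z - b)) ∈ Ckappa κ := fun b hb' =>
    Ckappa_translate hκ hc hu (hb b (hsr b hb'))
  have hsint : ∀ {φ : 𝔼 → ℝ}, Integrable (fun y => φ (s y)) μ := fun {φ} =>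
    (s.map φ).integrable_of_isFiniteMeasure
  set w : 𝔼 → ℝ := ∑ b ∈ s.range, μ.real (s ⁻¹' {b}) • fun z => u (z - b) with hw
  have hwz : ∀ z, w z = ∫ y, u (z - s y) ∂μ := fun z => by
    rw [integral_comp_simpleFunc s (fun b => u (z - b)), hw, Finset.sum_apply]
    rfl
  refine ⟨w, (convex_Ckappa hκ).sum_mem hw0 hwt hpm, fun z => ?_, ?_⟩
  · have hdiff : w z - smear μ u z = ∫ y, (u (z - s y) - u (z - y)) ∂μ := by
      rw [hwz, smear, integral_sub (hsint (φ := fun b => u (z - b)))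
        (integrable_translate hμ huc z)]
    have hbound : ∀ {b : ℝ}, (∀ y ∈ Metric.closedBall (0 : 𝔼) ρ,
        |u (z - s y) - u (z - y)| ≤ b) → |w z - smear μ u z| ≤ b := fun {b} hb => by
      rw [hdiff]
      have := norm_integral_le_of_norm_le_const (μ := μ)
        (f := fun y => u (z - s y) - u (z - y)) (hμ.mono hb)
      simpa using this
    refine le_weightCutoff hκ (by positivity) (hbound fun y hy => ?_) fun hz =>
      hbound fun y hy => ?_
    · refine (abs_sub _ _).trans ?_
      have := hub z _ (hsK y)
      have := hub z y hy
      rw [mul_div_assoc]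
      linarith
    · refine (h₁ _ (hball z _ hz _ (hsK y)) _ (hball z _ hz y hy) ?_).le
      rw [dist_sub_left]
      exact (hs y hy).trans_le (min_le_left _ _)
  · have hj := (hS.realValue_convex hκ t x).map_sum_le hw0 hwt hpm
    refine hj.trans ?_
    have hle : ∑ b ∈ s.range, μ.real (s ⁻¹' {b}) • realValue S t (fun z => u (z - b)) x ≤
        ∑ b ∈ s.range, μ.real (s ⁻¹' {b}) * (U (x - b) + e) :=
      Finset.sum_le_sum fun b hb' => mul_le_mul_of_nonneg_left (h b (hsr b hb')) (hw0 b hb')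
    refine hle.trans ?_
    rw [← integral_comp_simpleFunc s (fun b => U (x - b) + e)]
    have hint : Integrable (fun y => U (x - y) + e + ε) μ :=
      ((integrable_translate hμ hU x).add (integrable_const e)).add (integrable_const ε)
    refine (integral_mono_ae (hsint (φ := fun b => U (x - b) + e)) hint
      (hμ.mono fun y hy => ?_)).trans (le_of_eq ?_)
    · have := h₂ _ (hball x _ le_rfl _ (hsK y)) _ (hball x _ le_rfl y hy) (by
        rw [dist_sub_left]
        exact (hs y hy).trans_le (min_le_right _ _))
      rw [Real.dist_eq] at this
      have := (abs_lt.1 this).2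
      simp only
      linarith
    · rw [integral_add, integral_add (integrable_translate hμ hU x) (integrable_const e)]
      · simp [smear]
      · exact (integrable_translate hμ hU x).add (integrable_const e)
      · exact integrable_const _

end Shift

/-! ### Mollification -/

/-- The rescaled mollifier `y ↦ n ^ d η (n y)`. -/
def scaledMollifier {d : ℕ} (η : EuclideanSpace ℝ (Fin d) → ℝ) (n : ℕ)
    (y : EuclideanSpace ℝ (Fin d)) : ℝ :=
  (n : ℝ) ^ d * η ((n : ℝ) • y)

/-- The probability measure with density `y ↦ n ^ d η (n y)`. -/
def mollifierMeasure {d : ℕ} (η : EuclideanSpace ℝ (Fin d) → ℝ) (n : ℕ) :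
    Measure (EuclideanSpace ℝ (Fin d)) :=
  volume.withDensity fun y => ENNReal.ofReal (scaledMollifier η n y)

section Mollify

variable {d : ℕ} {η : EuclideanSpace ℝ (Fin d) → ℝ}

local notation "𝔼" => EuclideanSpace ℝ (Fin d)

theorem contDiff_pderiv {φ : 𝔼 → ℝ} (hφ : ContDiff ℝ ∞ φ) (i : Fin d) :
    ContDiff ℝ ∞ (pderiv i φ) :=
  (hφ.fderiv_right (by simp)).clm_apply contDiff_const

theorem hasCompactSupport_pderiv {φ : 𝔼 → ℝ} (hφ : HasCompactSupport φ) (i : Fin d) :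
    HasCompactSupport (pderiv i φ) :=
  hφ.fderiv_apply ℝ _

theorem convolution_eq_integral (f φ : 𝔼 → ℝ) (x : 𝔼) :
    convolution f φ (ContinuousLinearMap.mul ℝ ℝ) volume x = ∫ y, f y * φ (x - y) := rfl

theorem pderiv_convolution {f φ : 𝔼 → ℝ} (hf : LocallyIntegrable f volume)
    (hφ : ContDiff ℝ ∞ φ) (hφc : HasCompactSupport φ) (i : Fin d) :
    pderiv i (convolution f φ (ContinuousLinearMap.mul ℝ ℝ) volume) =
      convolution f (pderiv i φ) (ContinuousLinearMap.mul ℝ ℝ) volume := by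
  funext x
  rw [pderiv, (hφc.hasFDerivAt_convolution_right _ hf (hφ.of_le (by simp)) x).fderiv,
    convolution_precompR_apply _ hf (hφc.fderiv ℝ) (hφ.continuous_fderiv (by simp))]
  rfl

theorem iterate_pderiv_convolution {f φ : 𝔼 → ℝ} (hf : LocallyIntegrable f volume)
    (hφ : ContDiff ℝ ∞ φ) (hφc : HasCompactSupport φ) (i : Fin d) (k : ℕ) :
    (ContDiff ℝ ∞ ((pderiv i)^[k] φ) ∧ HasCompactSupport ((pderiv i)^[k] φ)) ∧
    (pderiv i)^[k] (convolution f φ (ContinuousLinearMap.mul ℝ ℝ) volume) =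
      convolution f ((pderiv i)^[k] φ) (ContinuousLinearMap.mul ℝ ℝ) volume := by
  induction k with
  | zero => exact ⟨⟨hφ, hφc⟩, rfl⟩
  | succ k ih =>
    simp only [Function.iterate_succ_apply', ih.2]
    exact ⟨⟨contDiff_pderiv ih.1.1 i, hasCompactSupport_pderiv ih.1.2 i⟩,
      pderiv_convolution hf ih.1.1 ih.1.2 i⟩

theorem multiDeriv_convolution {f φ : 𝔼 → ℝ} (hf : LocallyIntegrable f volume)
    (hφ : ContDiff ℝ ∞ φ) (hφc : HasCompactSupport φ) (α : Fin d → ℕ) :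
    multiDeriv α (convolution f φ (ContinuousLinearMap.mul ℝ ℝ) volume) =
      convolution f (multiDeriv α φ) (ContinuousLinearMap.mul ℝ ℝ) volume := by
  have h : ∀ l : List (Fin d), (ContDiff ℝ ∞ (l.foldr (fun i ψ => (pderiv i)^[α i] ψ) φ) ∧
      HasCompactSupport (l.foldr (fun i ψ => (pderiv i)^[α i] ψ) φ)) ∧
      l.foldr (fun i ψ => (pderiv i)^[α i] ψ)
        (convolution f φ (ContinuousLinearMap.mul ℝ ℝ) volume) =
      convolution f (l.foldr (fun i ψ => (pderiv i)^[α i] ψ) φ)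
        (ContinuousLinearMap.mul ℝ ℝ) volume := by
    intro l
    induction l with
    | nil => exact ⟨⟨hφ, hφc⟩, rfl⟩
    | cons i l ih =>
      simp only [List.foldr_cons, ih.2]
      exact iterate_pderiv_convolution hf ih.1.1 ih.1.2 i (α i)
  exact (h _).2

theorem iterate_pderiv_reflect {φ : 𝔼 → ℝ} (hφ : ContDiff ℝ ∞ φ) (x : 𝔼) (a : ℝ) (i : Fin d)
    (k : ℕ) : ContDiff ℝ ∞ ((pderiv i)^[k] φ) ∧ (pderiv i)^[k] (fun y => a * φ (x - y)) =
      fun y => (-1) ^ k * a * (pderiv i)^[k] φ (x - y) := by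
  induction k with
  | zero => simpa using hφ
  | succ k ih =>
    simp only [Function.iterate_succ_apply', ih.2]
    refine ⟨contDiff_pderiv ih.1 i, funext fun y => ?_⟩
    have hd : HasFDerivAt ((pderiv i)^[k] φ) (fderiv ℝ ((pderiv i)^[k] φ) (x - y)) (x - y) :=
      (ih.1.differentiable (by simp) _).hasFDerivAt
    have h1 := (hd.comp y ((hasFDerivAt_id y).const_sub x)).const_mul ((-1) ^ k * a)
    have h2 : fderiv ℝ (fun y => (-1) ^ k * a * (pderiv i)^[k] φ (x - y)) y = _ := h1.fderiv
    rw [pderiv, h2]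
    simp only [pderiv, smul_apply, ContinuousLinearMap.comp_apply,
      neg_apply, ContinuousLinearMap.id_apply, map_neg, smul_eq_mul]
    ring

theorem multiDeriv_reflect {φ : 𝔼 → ℝ} (hφ : ContDiff ℝ ∞ φ) (x : 𝔼) (α : Fin d → ℕ) (y : 𝔼) :
    multiDeriv α (fun y => φ (x - y)) y = (-1) ^ (∑ i, α i) * multiDeriv α φ (x - y) := by
  have h : ∀ l : List (Fin d), ContDiff ℝ ∞ (l.foldr (fun i ψ => (pderiv i)^[α i] ψ) φ) ∧
      l.foldr (fun i ψ => (pderiv i)^[α i] ψ) (fun y => φ (x - y)) =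
      fun y => (-1) ^ (l.map α).sum * l.foldr (fun i ψ => (pderiv i)^[α i] ψ) φ (x - y) := by
    intro l
    induction l with
    | nil => simpa using hφ
    | cons i l ih =>
      simp only [List.foldr_cons, ih.2, List.map_cons, List.sum_cons, pow_add]
      exact iterate_pderiv_reflect ih.1 x _ i (α i)
  rw [multiDeriv, (h _).2, Fin.sum_univ_def]
  rfl

theorem contDiff_scaledMollifier (hη : ContDiff ℝ ∞ η) (n : ℕ) :
    ContDiff ℝ ∞ (scaledMollifier η n) :=
  contDiff_const.mul (hη.comp (contDiff_const_smul _))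

theorem scaledMollifier_nonneg (hη0 : ∀ x, 0 ≤ η x) (n : ℕ) (y : 𝔼) :
    0 ≤ scaledMollifier η n y :=
  mul_nonneg (by positivity) (hη0 _)

theorem support_scaledMollifier (hηs : tsupport η ⊆ Metric.closedBall 0 1) {n : ℕ} (hn : 1 ≤ n) :
    Function.support (scaledMollifier η n) ⊆ Metric.closedBall 0 (1 / n) := by
  intro y hy
  have hn0 : (0 : ℝ) < n := by exact_mod_cast hn
  have h1 : (n : ℝ) • y ∈ Metric.closedBall (0 : 𝔼) 1 :=
    hηs (subset_tsupport _ (right_ne_zero_of_mul hy))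
  rw [mem_closedBall_zero_iff, norm_smul, Real.norm_of_nonneg hn0.le] at h1
  rw [mem_closedBall_zero_iff, le_div_iff₀ hn0]
  linarith

theorem hasCompactSupport_scaledMollifier (hηs : tsupport η ⊆ Metric.closedBall 0 1) {n : ℕ}
    (hn : 1 ≤ n) : HasCompactSupport (scaledMollifier η n) :=
  HasCompactSupport.of_support_subset_isCompact (isCompact_closedBall 0 _)
    (support_scaledMollifier hηs hn)

theorem measurable_scaledMollifier (hη : ContDiff ℝ ∞ η) (n : ℕ) :
    Measurable fun y => ENNReal.ofReal (scaledMollifier η n y) :=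
  (contDiff_scaledMollifier hη n).continuous.measurable.ennreal_ofReal

theorem smear_mollifierMeasure (hη : ContDiff ℝ ∞ η) (hη0 : ∀ x, 0 ≤ η x) (n : ℕ) (u : 𝔼 → ℝ)
    (x : 𝔼) :
    smear (mollifierMeasure η n) u x = ∫ y, scaledMollifier η n y * u (x - y) := by
  rw [smear, mollifierMeasure, integral_withDensity_eq_integral_toReal_smul
    (measurable_scaledMollifier hη n) (by simp)]
  simp_rw [ENNReal.toReal_ofReal (scaledMollifier_nonneg hη0 n _), smul_eq_mul]

theorem mollify_eq_smear (hη : ContDiff ℝ ∞ η) (hη0 : ∀ x, 0 ≤ η x) (n : ℕ) (u : 𝔼 → ℝ) :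
    mollify η u n = smear (mollifierMeasure η n) u := by
  funext x
  rw [smear_mollifierMeasure hη hη0, mollify]
  exact integral_congr_ae (Eventually.of_forall fun y => mul_comm _ _)

theorem smear_eq_convolution (hη : ContDiff ℝ ∞ η) (hη0 : ∀ x, 0 ≤ η x) (n : ℕ) (u : 𝔼 → ℝ) :
    smear (mollifierMeasure η n) u =
      convolution u (scaledMollifier η n) (ContinuousLinearMap.mul ℝ ℝ) volume := by
  funext x
  rw [smear_mollifierMeasure hη hη0, convolution_eq_integral,
    ← integral_sub_left_eq_self _ volume x]
  exact integral_congr_ae (Eventually.of_forall fun y => by simp [mul_comm])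

theorem isProbabilityMeasure_mollifierMeasure (hη : ContDiff ℝ ∞ η) (hη0 : ∀ x, 0 ≤ η x)
    (hηs : tsupport η ⊆ Metric.closedBall 0 1) (hηi : ∫ x, η x = 1) {n : ℕ} (hn : 1 ≤ n) :
    IsProbabilityMeasure (mollifierMeasure η n) := by
  constructor
  rw [mollifierMeasure, withDensity_apply _ MeasurableSet.univ, Measure.restrict_univ,
    ← ofReal_integral_eq_lintegral_ofReal 
      ((contDiff_scaledMollifier hη n).continuous.integrable_of_hasCompactSupport
      (hasCompactSupport_scaledMollifier hηs hn))
      (Eventually.of_forall (scaledMollifier_nonneg hη0 n))]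
  have hn0 : (0 : ℝ) < n := by exact_mod_cast hn
  simp only [scaledMollifier]
  rw [integral_const_mul, Measure.integral_comp_smul_of_nonneg _ _ _ (hR := hn0.le), hηi]
  simp [hn0.ne', finrank_euclideanSpace]

theorem ae_mollifierMeasure (hη : ContDiff ℝ ∞ η) (hηs : tsupport η ⊆ Metric.closedBall 0 1)
    {n : ℕ} (hn : 1 ≤ n) :
    ∀ᵐ y ∂mollifierMeasure η n, y ∈ Metric.closedBall (0 : 𝔼) (1 / n) := by
  rw [mollifierMeasure, ae_withDensity_iff (measurable_scaledMollifier hη n)]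
  refine Eventually.of_forall fun y hy => support_scaledMollifier hηs hn fun h => hy ?_
  rw [h, ENNReal.ofReal_zero]

/-- All derivatives fall on the mollifier. Testing the weak derivative against `y ↦ η_n (x - y)`
moves them onto `f`; the sign from the reflection cancels the sign in the definition. -/
theorem multiDeriv_smear (hη : ContDiff ℝ ∞ η) (hη0 : ∀ x, 0 ≤ η x)
    (hηs : tsupport η ⊆ Metric.closedBall 0 1) {n : ℕ} (hn : 1 ≤ n) {α : Fin d → ℕ}
    {f G : 𝔼 → ℝ} (hf : LocallyIntegrable f volume) (hG : HasWeakDeriv α f G) :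
    multiDeriv α (smear (mollifierMeasure η n) f) = smear (mollifierMeasure η n) G := by
  have hφ := contDiff_scaledMollifier hη n
  have hφc := hasCompactSupport_scaledMollifier hηs hn
  rw [smear_eq_convolution hη hη0, smear_eq_convolution hη hη0, multiDeriv_convolution hf hφ hφc]
  funext x
  have h := hG.2 (fun y => scaledMollifier η n (x - y))
    (hφ.comp (contDiff_const.sub contDiff_id))
    (hφc.comp_homeomorph (Homeomorph.subLeft x))
  simp_rw [multiDeriv_reflect hφ x α, mul_left_comm _ ((-1 : ℝ) ^ _), integral_const_mul] at h
  exact mul_left_cancel₀ (pow_ne_zero _ (by norm_num)) h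

theorem integrable_smear (hη : ContDiff ℝ ∞ η) (hη0 : ∀ x, 0 ≤ η x)
    (hηs : tsupport η ⊆ Metric.closedBall 0 1) {n : ℕ} (hn : 1 ≤ n) {G : 𝔼 → ℝ}
    (hG : LocallyIntegrable G volume) (x : 𝔼) :
    Integrable (fun y => G (x - y)) (mollifierMeasure η n) := by
  rw [mollifierMeasure, integrable_withDensity_iff_integrable_smul'
    (measurable_scaledMollifier hη n) (by simp)]
  simp_rw [ENNReal.toReal_ofReal (scaledMollifier_nonneg hη0 n _)]
  have h := (hG.integrable_smul_left_of_hasCompactSupport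
    (g := fun y => scaledMollifier η n (x - y))
    ((contDiff_scaledMollifier hη n).continuous.comp (continuous_const.sub continuous_id))
    ((hasCompactSupport_scaledMollifier hηs hn).comp_homeomorph
      (Homeomorph.subLeft x))).comp_sub_left x
  simpa using h

/-- Mollifications converge at Lebesgue points. -/
theorem ae_tendsto_smear (hη : ContDiff ℝ ∞ η) (hη0 : ∀ x, 0 ≤ η x)
    (hηs : tsupport η ⊆ Metric.closedBall 0 1) (hηi : ∫ x, η x = 1) {G : 𝔼 → ℝ}
    (hG : LocallyIntegrable G volume) :
    ∀ᵐ x, Tendsto (fun n => smear (mollifierMeasure η n) G x) atTop (𝓝 (G x)) := by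
  obtain ⟨C, hC⟩ : ∃ C, ∀ y, ‖η y‖ ≤ C := hη.continuous.bounded_above_of_compact_support
    (HasCompactSupport.of_support_subset_isCompact (isCompact_closedBall 0 1)
      ((subset_tsupport _).trans hηs))
  filter_upwards [IsUnifLocDoublingMeasure.ae_tendsto_average_norm_sub volume hG 1] with x hx
  have hr : Tendsto (fun n : ℕ => 1 / (n : ℝ)) atTop (𝓝[>] 0) :=
    tendsto_nhdsWithin_iff.2 ⟨tendsto_one_div_atTop_nhds_zero_nat,
      (eventually_gt_atTop 0).mono fun n hn => by
        have : (0 : ℝ) < n := by exact_mod_cast hn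
        simpa using this⟩
  have h1 := hx (fun _ : ℕ => x) (fun n : ℕ => 1 / (n : ℝ)) hr
    ((eventually_gt_atTop 0).mono fun n hn => Metric.mem_closedBall_self (by positivity))
  -- The density is at most `C n ^ d` on a ball of volume `n ^ (-d) V`, so the error is at most `C
  -- V` times the mean oscillation, which vanishes at Lebesgue points.
  set V := (volume : Measure 𝔼).real (Metric.closedBall 0 1)
  have h2 := h1.const_mul (C * V)
  rw [mul_zero] at h2
  rw [tendsto_iff_norm_sub_tendsto_zero]
  refine squeeze_zero' (Eventually.of_forall fun _ => norm_nonneg _)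
    ((eventually_ge_atTop 1).mono fun n hn => ?_) h2
  have hn0 : (0 : ℝ) < n := by exact_mod_cast hn
  have := isProbabilityMeasure_mollifierMeasure hη hη0 hηs hηi hn
  have hGi : LocallyIntegrable (fun y => ‖G y - G x‖) volume :=
    fun y => ((hG.sub (locallyIntegrable_const (G x))) y).norm
  have e1 : smear (mollifierMeasure η n) G x - G x =
      ∫ y, (G (x - y) - G x) ∂mollifierMeasure η n := by
    rw [integral_sub (integrable_smear hη hη0 hηs hn hG x) (integrable_const _)]
    simp [smear]
  have e2 : ∫ y, ‖G (x - y) - G x‖ ∂mollifierMeasure η n =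
      ∫ y, ‖G y - G x‖ * scaledMollifier η n (x - y) :=
    congrFun (smear_eq_convolution hη hη0 n (fun y => ‖G y - G x‖)) x
  have hvol : (volume : Measure 𝔼).real (Metric.closedBall x (1 / n)) = (1 / (n : ℝ)) ^ d * V := by
    rw [Measure.real, Measure.addHaar_closedBall' _ _ (by positivity), ENNReal.toReal_mul,
      ENNReal.toReal_ofReal (by positivity), finrank_euclideanSpace, Fintype.card_fin]
    rfl
  have hV : 0 < V := by
    refine ENNReal.toReal_pos (Metric.measure_closedBall_pos volume 0 one_pos).ne' ?_
    exact (isCompact_closedBall (0 : 𝔼) 1).measure_lt_top.ne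
  rw [e1]
  refine (norm_integral_le_integral_norm _).trans ?_
  have hint : IntegrableOn (fun y => ‖G y - G x‖) (Metric.closedBall x (1 / n)) volume :=
    hGi.integrableOn_isCompact (isCompact_closedBall _ _)
  rw [e2, setAverage_eq, hvol, ← setIntegral_eq_integral_of_forall_compl_eq_zero
    (s := Metric.closedBall x (1 / (n : ℝ)))]
  · have h3 : ∫ y in Metric.closedBall x (1 / (n : ℝ)), ‖G y - G x‖ * scaledMollifier η n (x - y) ≤
        ∫ y in Metric.closedBall x (1 / (n : ℝ)), ‖G y - G x‖ * ((n : ℝ) ^ d * C) := by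
      refine integral_mono_of_nonneg (Eventually.of_forall fun y =>
        mul_nonneg (norm_nonneg _) (scaledMollifier_nonneg hη0 n _)) (hint.mul_const _)
        (Eventually.of_forall fun y => ?_)
      exact mul_le_mul_of_nonneg_left (mul_le_mul_of_nonneg_left
        ((le_abs_self _).trans (hC _)) (by positivity)) (norm_nonneg _)
    refine h3.trans (le_of_eq ?_)
    rw [integral_mul_const, smul_eq_mul, one_div, inv_pow]
    field_simp
  · intro y hy
    have : scaledMollifier η n (x - y) = 0 := by
      by_contra h
      refine hy ?_
      have := support_scaledMollifier hηs hn h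
      rwa [mem_closedBall_zero_iff, ← dist_eq_norm, dist_comm] at this
    rw [this, mul_zero]

end Mollify

/-! ### Convex functions of possibly infinitely many variables -/

section Convex

variable {ι : Type*} {H : (ι → ℝ) → ℝ}

theorem continuous_of_convexOn_univ (hH : ConvexOn ℝ Set.univ H)
    (hc : Infinite ι → Continuous H) : Continuous H := by
  cases finite_or_infinite ι with
  | inl h =>
    have := Fintype.ofFinite ι
    exact continuousOn_univ.1 (hH.continuousOn isOpen_univ)
  | inr h => exact hc h

/-- A continuous convex function on a product space depends on finitely many coordinates only. -/
theorem exists_finset_dependsOn (hH : ConvexOn ℝ Set.univ H) (hc : Continuous H) :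
    ∃ T : Finset ι, ∀ v w : ι → ℝ, (∀ i ∈ T, v i = w i) → H v = H w := by
  have h1 : {v | H v < H 0 + 1} ∈ 𝓝 (0 : ι → ℝ) :=
    (isOpen_lt hc continuous_const).mem_nhds (by simp)
  rw [nhds_pi, Filter.mem_pi'] at h1
  obtain ⟨T, U, hU, hTU⟩ := h1
  -- A product neighbourhood of `0` restricts only the coordinates in `T`, so `H` is bounded above
  -- on the whole subspace where these vanish.
  have h2 : ∀ u : ι → ℝ, (∀ i ∈ T, u i = 0) → H u ≤ H 0 + 1 := fun u hu =>
    le_of_lt (hTU fun i hi => by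
      rw [hu i hi]
      exact mem_of_mem_nhds (hU i))
  have key : ∀ v w : ι → ℝ, (∀ i ∈ T, v i = w i) → H w ≤ H v := by
    intro v w hvw
    obtain ⟨B, hBdef⟩ : ∃ B, B = 1 / 2 * H ((2 : ℝ) • v) + 1 / 2 * (H 0 + 1) := ⟨_, rfl⟩
    -- The point is the midpoint of `2 v` and `2 s (w - v)`, and the latter vanishes on `T`.
    have hB : ∀ s : ℝ, H (v + s • (w - v)) ≤ B := by
      intro s
      have h3 := hH.2 (Set.mem_univ ((2 : ℝ) • v)) (Set.mem_univ ((2 * s) • (w - v)))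
        (by norm_num : (0 : ℝ) ≤ 1 / 2) (by norm_num : (0 : ℝ) ≤ 1 / 2) (by norm_num)
      have h4 := h2 ((2 * s) • (w - v)) fun i hi => by simp [hvw i hi]
      have h5 : (1 / 2 : ℝ) • (2 : ℝ) • v + (1 / 2 : ℝ) • (2 * s) • (w - v) =
          v + s • (w - v) := by
        rw [smul_smul, smul_smul, ← mul_assoc]
        norm_num
      rw [h5] at h3
      simp only [smul_eq_mul] at h3
      linarith
    -- A convex function bounded above along a line cannot increase on it: `w` is a convex
    -- combination of `v` and a far point of the line, whose weight tends to `0`.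
    have h6 : ∀ n : ℕ, H w ≤ H v + 1 / ((n : ℝ) + 1) * (B - H v) := by
      intro n
      have hn : (0 : ℝ) < n + 1 := by positivity
      have h7 : H ((1 - 1 / ((n : ℝ) + 1)) • v +
          (1 / ((n : ℝ) + 1)) • (v + ((n : ℝ) + 1) • (w - v))) ≤ (1 - 1 / ((n : ℝ) + 1)) • H v +
          (1 / ((n : ℝ) + 1)) • H (v + ((n : ℝ) + 1) • (w - v)) :=
        hH.2 (Set.mem_univ v) (Set.mem_univ _) (sub_nonneg.2 ((div_le_one hn).2
          (by linarith [(n.cast_nonneg : (0 : ℝ) ≤ n)])))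
        (by positivity) (by ring)
      have h8 : (1 - 1 / ((n : ℝ) + 1)) • v + (1 / ((n : ℝ) + 1)) • (v + ((n : ℝ) + 1) • (w - v))
          = w := by
        rw [smul_add, smul_smul, one_div_mul_cancel hn.ne', one_smul, sub_smul, one_smul]
        abel
      rw [h8] at h7
      simp only [smul_eq_mul] at h7
      have h9 := mul_le_mul_of_nonneg_left (hB ((n : ℝ) + 1))
        (by positivity : (0 : ℝ) ≤ 1 / ((n : ℝ) + 1))
      linarith
    have h10 := ((tendsto_one_div_add_atTop_nhds_zero_nat (𝕜 := ℝ)).mul_const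
      (B - H v)).const_add (H v)
    rw [zero_mul, add_zero] at h10
    exact ge_of_tendsto' h10 h6
  exact ⟨T, fun v w hvw => le_antisymm (key w v fun i hi => (hvw i hi).symm) (key v w hvw)⟩

/-- Jensen's inequality for continuous convex functions on a product space. -/
theorem jensen_pi (hH : ConvexOn ℝ Set.univ H) (hc : Continuous H) {Ω : Type*}
    [MeasurableSpace Ω] {μ : Measure Ω} [IsProbabilityMeasure μ] {V : ι → Ω → ℝ}
    (hV : ∀ i, Integrable (V i) μ) (hHV : Integrable (fun y => H fun i => V i y) μ) :
    H (fun i => ∫ y, V i y ∂μ) ≤ ∫ y, H (fun i => V i y) ∂μ := by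
  classical
  obtain ⟨T, hT⟩ := exists_finset_dependsOn hH hc
  -- Extension by zero identifies `H` with a convex function on a finite-dimensional space, where
  -- the integral Jensen inequality is available.
  let E : (T → ℝ) →ₗ[ℝ] (ι → ℝ) :=
    { toFun := fun v i => if h : i ∈ T then v ⟨i, h⟩ else 0
      map_add' := fun v w => by
        funext i
        by_cases h : i ∈ T <;> simp [h]
      map_smul' := fun a v => by
        funext i
        by_cases h : i ∈ T <;> simp [h] }
  have hE : ∀ v : ι → ℝ, H (E fun i : T => v i) = H v := fun v => hT _ _ fun i hi => by
    simp [E, hi]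
  have hEV : ∀ y, H (E fun i : T => V i y) = H fun i => V i y := fun y => hE fun i => V i y
  have hconv : ConvexOn ℝ Set.univ fun v => H (E v) := by
    have := hH.comp_linearMap E
    rwa [Set.preimage_univ] at this
  have hint : Integrable (fun y => fun i : T => V i y) μ := Integrable.of_eval fun i => hV i
  have h := hconv.map_integral_le (f := fun y => fun i : T => V i y) (μ := μ)
    (hconv.continuousOn isOpen_univ) isClosed_univ (by simp) hint
    (by simpa only [Function.comp_def, hEV] using hHV)
  have h2 : ∫ y, (fun i : T => V i y) ∂μ = fun i : T => ∫ y, V i y ∂μ := by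
    funext i
    exact eval_integral (f := fun y (i : T) => V i y) (fun i => hV i) i
  rw [h2, hE fun i => ∫ y, V i y ∂μ] at h
  simpa only [hEV] using h

end Convex

/-! ### The upper semicontinuous hull of the ball averages -/

section Hull

variable {d : ℕ} {g : EuclideanSpace ℝ (Fin d) → ℝ}

theorem upperSemicontinuous_uscHull (g : EuclideanSpace ℝ (Fin d) → ℝ) :
    UpperSemicontinuous (uscHull g) := by
  intro x c hc
  obtain ⟨b, hb, hbc⟩ := exists_between hc
  have h : ∀ᶠ y in 𝓝[avgSet g] x, (avgRep g y : EReal) < b := eventually_lt_of_limsup_lt hb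
  filter_upwards [eventually_nhds_nhdsWithin.2 h] with z hz
  exact lt_of_le_of_lt (limsup_le_of_le (h := hz.mono fun y hy => hy.le)) hbc

theorem tendsto_avgRep {x : EuclideanSpace ℝ (Fin d)} (hx : x ∈ avgSet g) :
    Tendsto (fun r : ℝ => ⨍ y in Metric.closedBall x r, g y) (𝓝[>] 0) (𝓝 (avgRep g x)) :=
  tendsto_nhds_limUnder hx

/-- At a Lebesgue point the averages converge to `g x`, and the limit superior admits the point
itself. -/
theorem ae_le_uscHull (hg : LocallyIntegrable g volume) :
    ∀ᵐ x, (g x : EReal) ≤ uscHull g x := by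
  filter_upwards [IsUnifLocDoublingMeasure.ae_tendsto_average volume hg 1] with x hx
  have h := hx (fun _ : ℝ => x) (fun r => r) tendsto_id (by
    filter_upwards [self_mem_nhdsWithin] with r hr
    exact Metric.mem_closedBall_self (by simpa using (Set.mem_Ioi.1 hr).le))
  have hx' : x ∈ avgSet g := ⟨g x, h⟩
  rw [← tendsto_nhds_unique (tendsto_avgRep hx') h]
  refine le_limsup_of_frequently_le ?_
  rw [frequently_iff]
  exact fun hU => ⟨x, mem_of_mem_nhdsWithin hx' hU, le_rfl⟩

/-- Averages over small balls inside `U` ignore null sets. The contrapositive yields the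
positive-measure set needed for the lower bound. -/
theorem uscHull_le_of_ae_le_on (hg : LocallyIntegrable g volume)
    {U : Set (EuclideanSpace ℝ (Fin d))} (hU : IsOpen U) {a : ℝ}
    (h : ∀ᵐ z, z ∈ U → g z ≤ a) {x : EuclideanSpace ℝ (Fin d)} (hx : x ∈ U) :
    uscHull g x ≤ a := by
  refine limsup_le_of_le (h := ?_)
  filter_upwards [self_mem_nhdsWithin, mem_nhdsWithin_of_mem_nhds (hU.mem_nhds hx)] with y hy hyU
  obtain ⟨ρ, hρ, hball⟩ := Metric.nhds_basis_closedBall.mem_iff.1 (hU.mem_nhds hyU)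
  refine EReal.coe_le_coe_iff.2 (le_of_tendsto (tendsto_avgRep hy) ?_)
  filter_upwards [Ioc_mem_nhdsGT hρ] with r hr
  refine (convex_Iic a).set_average_mem isClosed_Iic
    (Metric.measure_closedBall_pos volume y hr.1).ne'
    (isCompact_closedBall y r).measure_lt_top.ne ?_
    (hg.integrableOn_isCompact (isCompact_closedBall y r))
  rw [ae_restrict_iff' Metric.isClosed_closedBall.measurableSet]
  filter_upwards [h] with z hz hzr
  exact hz (hball (Metric.closedBall_subset_closedBall hr.2 hzr))

theorem uscHull_le_of_ae_le (hg : LocallyIntegrable g volume)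
    {b : EuclideanSpace ℝ (Fin d) → ℝ} (hb : Continuous b) (h : ∀ᵐ z, g z ≤ b z)
    (x : EuclideanSpace ℝ (Fin d)) : uscHull g x ≤ b x := by
  refine EReal.le_of_forall_lt_iff_le.1 fun a ha => ?_
  refine uscHull_le_of_ae_le_on hg (isOpen_lt hb continuous_const) (h.mono fun z hz hza => ?_)
    (EReal.coe_lt_coe_iff.1 ha)
  exact hz.trans (le_of_lt hza)

end Hull

/-! ### Diagonal selection -/

section Diagonal

theorem exists_seq_tendsto_of_eventually {Y Z : Type*} {F : Filter Z} [F.IsCountablyGenerated]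
    {Φ : ℕ → Y → Z} (y₀ : Y) (h : ∀ V ∈ F, ∀ᶠ k in atTop, ∃ y, Φ k y ∈ V) :
    ∃ y : ℕ → Y, Tendsto (fun k => Φ k (y k)) atTop F := by
  classical
  obtain ⟨V, hV⟩ := F.exists_antitone_basis
  -- `J k` is the finest of the first basis sets that `Φ k` can reach; it exceeds every fixed index
  -- eventually.
  let J : ℕ → ℕ := fun k => Nat.findGreatest (fun j => ∃ y, Φ k y ∈ V j) k
  refine ⟨fun k => if hk : ∃ y, Φ k y ∈ V (J k) then hk.choose else y₀, ?_⟩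
  rw [hV.tendsto_right_iff]
  intro j _
  filter_upwards [h (V j) (hV.mem j), eventually_ge_atTop j] with k hk hjk
  have h1 : ∃ y, Φ k y ∈ V (J k) :=
    Nat.findGreatest_spec (P := fun j => ∃ y, Φ k y ∈ V j) hjk hk
  rw [dif_pos h1]
  exact hV.antitone (Nat.le_findGreatest hjk hk) h1.choose_spec

end Diagonal

/-! ### Semigroup estimates -/

section Semigroup

variable {d : ℕ} {κ : EuclideanSpace ℝ (Fin d) → ℝ}
  {S : ℝ≥0 → (EuclideanSpace ℝ (Fin d) → ℝ) → EuclideanSpace ℝ (Fin d) → EReal}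

local notation "𝔼" => EuclideanSpace ℝ (Fin d)

namespace IsConvexMonotoneFamily

theorem realValue_mem (hS : IsConvexMonotoneFamily κ S) (hκ : ∀ x, 0 < κ x) {f : 𝔼 → ℝ}
    (hf : f ∈ upperLipschitzSet κ S) (t : ℝ≥0) : realValue S t f ∈ Ckappa κ := by
  obtain ⟨g, hg, hgt, -⟩ := hf.2.1 t
  have : realValue S t f = g := funext fun x => by
    rw [← EReal.coe_eq_coe_iff, hS.coe_realValue hκ hf.1, hgt]
  rwa [this]

theorem realValue_add (hS : IsConvexMonotoneFamily κ S) (hκ : ∀ x, 0 < κ x) {f : 𝔼 → ℝ}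
    (hf : f ∈ upperLipschitzSet κ S) (s t : ℝ≥0) (x : 𝔼) :
    realValue S (s + t) f x = realValue S s (realValue S t f) x := by
  obtain ⟨g, hg, hgt, hst⟩ := hf.2.1 t
  have : realValue S t f = g := funext fun x => by
    rw [← EReal.coe_eq_coe_iff, hS.coe_realValue hκ hf.1, hgt]
  rw [this, realValue, hst, realValue]

theorem exists_realValue_le (hS : IsConvexMonotoneFamily κ S) (hκ : ∀ x, 0 < κ x) {f : 𝔼 → ℝ}
    (hf : f ∈ upperLipschitzSet κ S) : ∃ h₀ : ℝ≥0, 0 < h₀ ∧ ∃ c : ℝ, 0 ≤ c ∧ ∀ h ≤ h₀, ∀ x,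
      realValue S h f x ≤ f x + c * h / κ x := by
  obtain ⟨h₀, hh₀, c, hc⟩ := hf.2.2
  refine ⟨h₀, hh₀, c, c.2, fun h hh x => ?_⟩
  have h1 := (le_kappaNorm κ _ x).trans (hc h hh)
  rw [← hS.coe_realValue hκ hf.1, ← EReal.coe_sub, ← EReal.coe_zero,
    ← EReal.coe_strictMono.monotone.map_max, EReal.abs_def,
    ← ENNReal.ofReal_mul (abs_nonneg _)] at h1
  have h2 : ((c : ℝ≥0∞) * h) = ENNReal.ofReal ((c : ℝ) * h) := by
    rw [ENNReal.ofReal_mul c.coe_nonneg, ENNReal.ofReal_coe_nnreal, ENNReal.ofReal_coe_nnreal]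
  rw [h2, ENNReal.ofReal_le_ofReal_iff (by positivity)] at h1
  have h3 := (le_div_iff₀ (hκ x)).2 h1
  have h4 := (le_max_left _ _).trans ((le_abs_self _).trans h3)
  linarith

theorem diffQuotient_eq (hS : IsConvexMonotoneFamily κ S) (hκ : ∀ x, 0 < κ x) {f : 𝔼 → ℝ}
    (hf : f ∈ Ckappa κ) (h : ℝ≥0) (x : 𝔼) :
    diffQuotient S f h x = (((realValue S h f x - f x) / h : ℝ) : EReal) := by
  rw [diffQuotient, ← hS.coe_realValue hκ hf, EReal.coe_div, EReal.coe_sub]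

/-- The bound on the difference quotients is evaluated along a recovery sequence and passes to the
limit by continuity of `b`. -/
theorem le_of_isGammaDeriv (hS : IsConvexMonotoneFamily κ S) (hκ : ∀ x, 0 < κ x) {u G : 𝔼 → ℝ}
    (hu : u ∈ Ckappa κ) (hG : IsGammaDeriv κ S u (fun x => (G x : EReal))) {b : 𝔼 → ℝ}
    (hb : Continuous b) {h₁ : ℝ≥0} (hh₁ : 0 < h₁)
    (hle : ∀ h ≤ h₁, ∀ x, realValue S h u x ≤ u x + h * b x) (x : 𝔼) : G x ≤ b x := by
  obtain ⟨h, -, hh, hlim⟩ := exists_seq_strictAnti_tendsto (0 : ℝ≥0)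
  obtain ⟨y, hy, hyG⟩ := (hG.2 h hh hlim x).2
  simp_rw [hS.diffQuotient_eq hκ hu] at hyG
  refine le_of_tendsto_of_tendsto (EReal.tendsto_coe.1 hyG) ((hb.tendsto x).comp hy) ?_
  filter_upwards [hlim.eventually_le_const hh₁] with k hk
  have hk0 : (0 : ℝ) < h k := hh k
  rw [div_le_iff₀ hk0, Function.comp_apply]
  linarith [hle (h k) hk (y k)]

end IsConvexMonotoneFamily

end Semigroup

/-! ### From infinitesimal bounds to increments of the semigroup -/

section Comparison

variable {d : ℕ} {κ : EuclideanSpace ℝ (Fin d) → ℝ}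
  {S : ℝ≥0 → (EuclideanSpace ℝ (Fin d) → ℝ) → EuclideanSpace ℝ (Fin d) → EReal}

local notation "𝔼" => EuclideanSpace ℝ (Fin d)

namespace IsConvexMonotoneFamily

/-- A strict pointwise bound on the `Γ`-derivative over a compact set, together with a uniform
bound elsewhere, bounds the increments of the semigroup. -/
theorem exists_realValue_le_add_mul (hS : IsConvexMonotoneFamily κ S) (hκ : ∀ x, 0 < κ x)
    {u G : 𝔼 → ℝ} (hu : u ∈ Ckappa κ) (hG : IsGammaDeriv κ S u (fun x => (G x : EReal)))
    {w b : 𝔼 → ℝ} (hw : Continuous w) {h₁ : ℝ≥0} (hh₁ : 0 < h₁)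
    (hb : ∀ h ≤ h₁, ∀ x, realValue S h u x ≤ u x + h * b x) {K : Set 𝔼} (hK : IsCompact K)
    (hGw : ∀ x ∈ K, G x < w x) (hbw : ∀ x ∉ K, b x ≤ w x) :
    ∃ h₂ : ℝ≥0, 0 < h₂ ∧ ∀ h ≤ h₂, ∀ x, realValue S h u x ≤ u x + h * w x := by
  by_contra! hcon
  obtain ⟨η, -, hη, hlim⟩ := exists_seq_strictAnti_tendsto (0 : ℝ≥0)
  choose h hh x hx using fun k => hcon (min h₁ (η k)) (lt_min hh₁ (hη k))
  have hhlim : Tendsto h atTop (𝓝 0) :=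
    tendsto_of_tendsto_of_tendsto_of_le_of_le tendsto_const_nhds hlim (fun _ => zero_le)
      fun k => (hh k).trans (min_le_right _ _)
  have hpos : ∀ k, 0 < h k := fun k => by
    rw [pos_iff_ne_zero]
    intro h0
    have := hx k
    rw [h0, hS.realValue_at_zero hu] at this
    simp at this
  -- Outside `K` the a priori bound `b ≤ w` excludes a violation, so violating points accumulate at
  -- some `z ∈ K`, where the Γ-limsup inequality forces `w z ≤ G z`.
  have hxK : ∀ k, x k ∈ K := fun k => by
    by_contra hxk
    have h1 := hb (h k) ((hh k).trans (min_le_left _ _)) (x k)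
    have h2 := mul_le_mul_of_nonneg_left (hbw _ hxk) (h k).coe_nonneg
    linarith [hx k]
  obtain ⟨z, hz, φ, hφ, hφz⟩ := hK.tendsto_subseq hxK
  have hlimsup := (hG.2 (fun k => h (φ k)) (fun k => hpos _) (hhlim.comp hφ.tendsto_atTop) z).1
    (fun k => x (φ k)) hφz
  obtain ⟨a, ha, haw⟩ := exists_between (hGw z hz)
  have h3 : (a : EReal) ≤ limsup (fun k => diffQuotient S u (h (φ k)) (x (φ k))) atTop := by
    refine le_limsup_of_frequently_le (Eventually.frequently ?_)
    filter_upwards [((hw.tendsto z).comp hφz).eventually_const_lt haw] with k hk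
    have hk0 : (0 : ℝ) < h (φ k) := hpos _
    rw [hS.diffQuotient_eq hκ hu, EReal.coe_le_coe_iff, le_div_iff₀ hk0]
    have := hx (φ k)
    have := mul_le_mul_of_nonneg_left hk.le hk0.le
    simp only [Function.comp_apply] at this
    linarith
  exact absurd ha (not_lt.2 (EReal.coe_le_coe_iff.1 (h3.trans hlimsup)))

/-- Telescoping of increments of the semigroup. -/
theorem realValue_sub_le_mul (hS : IsConvexMonotoneFamily κ S) (hκ : ∀ x, 0 < κ x) {u : 𝔼 → ℝ}
    (hu : u ∈ upperLipschitzSet κ S) {w : 𝔼 → ℝ} (hw : w ∈ Ckappa κ) {h₂ : ℝ≥0} (hh₂ : 0 < h₂)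
    (hle : ∀ h ≤ h₂, ∀ x, realValue S h u x ≤ u x + h * w x) {x : 𝔼} {s₀ : ℝ≥0} {B : ℝ}
    (hB : ∀ s ≤ s₀, realValue S s (u + w) x - realValue S s u x ≤ B) {t : ℝ≥0} (ht : t ≤ s₀) :
    realValue S t u x - u x ≤ t * B := by
  -- The step size `t / N` is at most `h₂`, for the increment bound, and at most `1`, to serve as a
  -- convex weight.
  obtain ⟨N, hN⟩ := exists_nat_gt (t / min h₂ 1)
  have hm : 0 < min h₂ 1 := lt_min hh₂ one_pos
  have hN0 : (0 : ℝ≥0) < N := zero_le.trans_lt hN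
  set h : ℝ≥0 := t / N with hh
  have hhm : h ≤ min h₂ 1 := by
    rw [div_lt_iff₀ hm] at hN
    rw [hh, div_le_iff₀ hN0]
    rw [mul_comm]
    exact hN.le
  have hh1 : (h : ℝ) ≤ 1 := by exact_mod_cast hhm.trans (min_le_right _ _)
  have hNh : (N : ℝ≥0) * h = t := mul_div_cancel₀ _ hN0.ne'
  have huw := Ckappa_add hκ hu.1 hw
  have step : ∀ k : ℕ, k ≤ N → realValue S (k * h) u x - u x ≤ k * h * B := by
    intro k
    induction k with
    | zero => simp [hS.realValue_at_zero hu.1]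
    | succ k ih =>
      intro hk
      have hks : (k : ℝ≥0) * h ≤ s₀ := by
        refine le_trans ?_ (hNh.trans_le ht)
        gcongr
        omega
      have e1 : ((k + 1 : ℕ) : ℝ≥0) * h = k * h + h := by push_cast; ring
      rw [e1, hS.realValue_add hκ hu]
      -- Writing `u + h w = (1 - h) u + h (u + w)`, convexity of `S (k h)` bounds one increment by
      -- `h (S (k h) (u + w) - S (k h) u) ≤ h B`. The bound does not involve `h₂`.
      have hcv : (1 - (h : ℝ)) • u + (h : ℝ) • (u + w) ∈ Ckappa κ :=
        convex_Ckappa hκ hu.1 huw (by linarith) h.coe_nonneg (by ring)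
      have e2 := hS.realValue_mono hκ (hS.realValue_mem hκ hu h) hcv (fun y => by
        have := hle h (hhm.trans (min_le_left _ _)) y
        simp only [Pi.add_apply, Pi.smul_apply, smul_eq_mul]
        linarith) (k * h) x
      have e3 := (hS.realValue_convex hκ (k * h) x).2 hu.1 huw
        (by linarith : (0 : ℝ) ≤ 1 - h) h.coe_nonneg (by ring)
      have e4 := mul_le_mul_of_nonneg_left (hB _ hks) h.coe_nonneg
      have e5 := ih (by omega)
      simp only [smul_eq_mul] at e3
      push_cast
      linarith
  have := step N le_rfl
  rw [hNh] at this
  have e : (N : ℝ) * h = t := by exact_mod_cast hNh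
  rwa [e] at this

end IsConvexMonotoneFamily

/-- Uniform continuity on a large ball handles the region near the origin, and the weight handles
the rest. The constant `M` must not depend on `m`, since it is fixed before approximating. -/
theorem abs_smear_sub_le_weightCutoff (hκ : ∀ x, 0 < κ x) {c : ℝ}
    (hc : ∀ x y : 𝔼, ‖y‖ ≤ 1 → κ x / κ (x - y) ≤ c) {f : 𝔼 → ℝ} (hf : f ∈ Ckappa κ) :
    ∃ M : ℝ, 0 ≤ M ∧ ∀ m : ℕ, ∃ ρ₀ : ℝ, 0 < ρ₀ ∧ ∀ ρ ≤ ρ₀, ∀ μ : Measure 𝔼,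
      IsProbabilityMeasure μ → (∀ᵐ y ∂μ, y ∈ Metric.closedBall (0 : 𝔼) ρ) →
      ∀ x, |smear μ f x - f x| ≤ weightCutoff κ M m x := by
  obtain ⟨hfc, M, hM, hfM⟩ := (mem_Ckappa_iff hκ).1 hf
  have hc0 : 0 ≤ c := (div_pos (hκ 0) (hκ _)).le.trans (hc 0 0 (by simp))
  refine ⟨c * M + M, by positivity, fun m => ?_⟩
  obtain ⟨δ, hδ, h⟩ := Metric.uniformContinuousOn_iff.1
    ((isCompact_closedBall (0 : 𝔼) (m + 1 + 1)).uniformContinuousOn_of_continuous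
      hfc.continuousOn) (1 / ((m : ℝ) + 1)) (by positivity)
  refine ⟨min 1 (δ / 2), by positivity, fun ρ hρ μ _ hμ x => ?_⟩
  have hy1 : ∀ y ∈ Metric.closedBall (0 : 𝔼) ρ, ‖y‖ ≤ 1 := fun y hy =>
    (mem_closedBall_zero_iff.1 hy).trans (hρ.trans (min_le_left _ _))
  refine le_weightCutoff hκ (by positivity) (abs_smear_sub_le hμ hfc fun y hy => ?_) fun hx =>
    abs_smear_sub_le hμ hfc fun y hy => ?_
  · rw [add_div]
    exact (abs_sub _ _).trans (add_le_add ((hfM _).trans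
      (div_weight_translate_le hκ hc hM x (hy1 y hy))) (hfM x))
  · refine (h (x - y) ?_ x ?_ ?_).le
    · rw [mem_closedBall_zero_iff]
      linarith [norm_sub_le x y, hy1 y hy]
    · rw [mem_closedBall_zero_iff]
      linarith
    · rw [dist_eq_norm, sub_sub_cancel_left, norm_neg]
      linarith [(mem_closedBall_zero_iff.1 hy).trans (hρ.trans (min_le_right _ _))]

theorem smear_le_smear_add {μ : Measure 𝔼} [IsProbabilityMeasure μ] {ρ : ℝ}
    (hμ : ∀ᵐ y ∂μ, y ∈ Metric.closedBall (0 : 𝔼) ρ) {u v : 𝔼 → ℝ} (hu : Continuous u)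
    (hv : Continuous v) {x : 𝔼} {b : ℝ}
    (h : ∀ y ∈ Metric.closedBall (0 : 𝔼) ρ, u (x - y) ≤ v (x - y) + b) :
    smear μ u x ≤ smear μ v x + b := by
  have h1 := smear_le hμ (hu.sub hv) (x := x) (b := b) fun y hy => by
    simp only [Pi.sub_apply]
    linarith [h y hy]
  have h2 : smear μ (u - v) x = smear μ u x - smear μ v x :=
    integral_sub (integrable_translate hμ hu x) (integrable_translate hμ hv x)
  linarith

/-- The real-valued form of the approximate translation invariance. -/
theorem IsConvexMonotoneFamily.realValue_translate_le (hS : IsConvexMonotoneFamily κ S)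
    (hκ : ∀ x, 0 < κ x) {c : ℝ} (hc : ∀ x y : 𝔼, ‖y‖ ≤ 1 → κ x / κ (x - y) ≤ c) {f : 𝔼 → ℝ}
    (hf : f ∈ Ckappa κ) {t : ℝ≥0} {e : ℝ} (he : 0 ≤ e) {y : 𝔼} (hy : ‖y‖ ≤ 1)
    (h : kappaNorm κ (fun z => S t (fun z' => f (-y + z')) z - S t f (-y + z)) ≤
      ENNReal.ofReal e) (x : 𝔼) :
    realValue S t (fun z => f (z - y)) x ≤ realValue S t f (x - y) + e / κ x := by
  simp_rw [neg_add_eq_sub] at h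
  have h2 : ∀ z, S t (fun z' => f (z' - y)) z - S t f (z - y) =
      ((realValue S t (fun z' => f (z' - y)) z - realValue S t f (z - y) : ℝ) : EReal) := by
    intro z
    rw [EReal.coe_sub, hS.coe_realValue hκ (Ckappa_translate hκ hc hf hy), hS.coe_realValue hκ hf]
  simp_rw [h2] at h
  have := (abs_le.1 ((kappaNorm_coe_le_iff hκ he).1 h x)).2
  linarith

end Comparison

/-! ### Upper and lower bounds on difference quotients -/

section Bounds

variable {d : ℕ} {κ : EuclideanSpace ℝ (Fin d) → ℝ}
  {S : ℝ≥0 → (EuclideanSpace ℝ (Fin d) → ℝ) → EuclideanSpace ℝ (Fin d) → EReal}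

local notation "𝔼" => EuclideanSpace ℝ (Fin d)

namespace IsConvexMonotoneFamily

/-- Local upper bounds on the `Γ`-derivatives of approximations bound the increments of the
semigroup at the limit. -/
theorem exists_realValue_sub_le_of_approx (hS : IsConvexMonotoneFamily κ S) (hκ : ∀ x, 0 < κ x)
    (hcont : Continuous κ) (hbdd : ∃ C : ℝ, ∀ x, κ x ≤ C) {f : 𝔼 → ℝ} (hf : f ∈ Ckappa κ)
    {u G : ℕ → 𝔼 → ℝ} (hu : ∀ᶠ n in atTop, u n ∈ upperLipschitzSet κ S)
    (hG : ∀ᶠ n in atTop, IsGammaDeriv κ S (u n) (fun x => (G n x : EReal)))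
    {M : ℝ} (hM : 0 ≤ M)
    (huf : ∀ m : ℕ, ∀ᶠ n in atTop, ∀ x, |u n x - f x| ≤ weightCutoff κ M m x)
    {C : ℝ} (hC : 0 ≤ C) {h₁ : ℝ≥0} (hh₁ : 0 < h₁)
    (hCu : ∀ᶠ n in atTop, ∀ h ≤ h₁, ∀ x, realValue S h (u n) x ≤ u n x + h * (C / κ x))
    {x₀ : 𝔼} {r : ℝ} (hr : 0 < r) {a' a : ℝ} (ha : a' < a)
    (hGa : ∀ᶠ n in atTop, ∀ x ∈ Metric.closedBall x₀ r, G n x ≤ a') :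
    ∃ s₀ : ℝ≥0, 0 < s₀ ∧ ∀ᶠ x in 𝓝 x₀, ∀ t ≤ s₀, realValue S t f x - f x ≤ t * a := by
  -- One `ε` makes `G n < w` strict on the ball; the other two pay for the errors in `e1` and `e2`.
  obtain ⟨ε, hε, ha''⟩ : ∃ ε : ℝ, 0 < ε ∧ a' + ε + 2 * ε = a :=
    ⟨(a - a') / 3, by linarith, by ring⟩
  set a'' := a' + ε
  have hκ0 : ∀ x, κ x ≠ 0 := fun x => (hκ x).ne'
  -- A continuous majorant equal to `a''` at `x₀` that has risen to at least `C / κ` at distance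
  -- `r`.
  let w : 𝔼 → ℝ := fun x => a'' + max (C / κ x - a'') 0 * min 1 (dist x x₀ / r)
  have hθ : ∀ x, 0 ≤ min 1 (dist x x₀ / r) := fun x => le_min zero_le_one (by positivity)
  have hwc : Continuous w := by
    have := hr.ne'
    unfold w
    fun_prop (disch := assumption)
  have hw : w ∈ Ckappa κ := by
    refine Ckappa_of_bounded_div hκ hbdd (a := 2 * |a''|) (M := C) hwc (by positivity) hC
      fun x => ?_
    have h0 : 0 ≤ C / κ x := div_nonneg hC (hκ x).le
    have h1 : max (C / κ x - a'') 0 ≤ C / κ x + |a''| :=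
      max_le (by linarith [neg_abs_le a'']) (by positivity)
    have h2 : max (C / κ x - a'') 0 * min 1 (dist x x₀ / r) ≤ C / κ x + |a''| :=
      (mul_le_of_le_one_right (le_max_right _ _) (min_le_left _ _)).trans h1
    have h3 : 0 ≤ max (C / κ x - a'') 0 * min 1 (dist x x₀ / r) :=
      mul_nonneg (le_max_right _ _) (hθ x)
    refine (abs_add_le _ _).trans ?_
    rw [abs_of_nonneg h3]
    linarith
  have hw0 : w x₀ = a'' := by simp [w]
  have hwa : ∀ x, a'' ≤ w x := fun x =>
    le_add_of_nonneg_right (mul_nonneg (le_max_right _ _) (hθ x))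
  have hwC : ∀ x ∉ Metric.closedBall x₀ r, C / κ x ≤ w x := fun x hx => by
    have h1 : 1 ≤ dist x x₀ / r := by
      rw [le_div_iff₀ hr, one_mul]
      exact (not_le.1 hx).le
    simp only [w, min_eq_left h1, mul_one]
    linarith [le_max_left (C / κ x - a'') 0]
  obtain ⟨m, hm⟩ := ((tendsto_weightCutoff (κ := κ) M x₀).eventually_lt_const hε).exists
  have hv := weightCutoff_mem hκ hcont hbdd hM m
  have hfv := Ckappa_add hκ hf hv
  have hfvw := Ckappa_add hκ hfv hw
  have hnfv := Ckappa_add hκ (Ckappa_neg hκ hf) hv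
  -- The functions `f + v + w` and `-f + v` dominate `u n + w` and `-u n` for all large `n`, so the
  -- resulting neighbourhood of `(0, x₀)` is independent of `n`.
  have e1 := hS.eventually_realValue_lt hκ hfvw (x := x₀) (b := f x₀ + a'' + ε) (by
    simp only [Pi.add_apply, hw0]
    linarith)
  have e2 := hS.eventually_realValue_lt hκ hnfv (x := x₀) (b := -f x₀ + ε) (by
    simp only [Pi.add_apply, Pi.neg_apply]
    linarith)
  have e3 := e1.and e2
  rw [nhds_prod_eq] at e3
  obtain ⟨P, hP, Q, hQ, hPQ⟩ := eventually_prod_iff.1 e3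
  obtain ⟨s₁, hs₁, hs₁P⟩ := Metric.nhds_basis_closedBall.eventually_iff.1 hP
  refine ⟨⟨s₁, hs₁.le⟩, hs₁, hQ.mono fun x hx t ht => ?_⟩
  have hB : ∀ᶠ n in atTop, realValue S t (u n) x - u n x ≤ t * a := by
    filter_upwards [hu, hG, huf m, hCu, hGa] with n hun hGn hufn hCn hGan
    obtain ⟨h₂, hh₂, hle⟩ := hS.exists_realValue_le_add_mul hκ hun.1 hGn hwc hh₁ hCn
      (isCompact_closedBall x₀ r)
      (fun x hx => (hGan x hx).trans_lt ((lt_add_of_pos_right a' hε).trans_le (hwa x))) hwC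
    refine hS.realValue_sub_le_mul hκ hun hw hh₂ hle (s₀ := ⟨s₁, hs₁.le⟩) (fun s hs => ?_) ht
    have hsP : P s := hs₁P (by
      rw [Metric.mem_closedBall, NNReal.dist_eq, NNReal.coe_zero, sub_zero,
        abs_of_nonneg s.coe_nonneg]
      exact hs)
    obtain ⟨hlt1, hlt2⟩ := hPQ hsP hx
    have h1 := hS.realValue_mono hκ (Ckappa_add hκ hun.1 hw) hfvw (fun y => by
      have := (abs_le.1 (hufn y)).2
      simp only [Pi.add_apply]
      linarith) s x
    have h2 := hS.realValue_mono hκ (Ckappa_neg hκ hun.1) hnfv (fun y => by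
      have := (abs_le.1 (hufn y)).1
      simp only [Pi.add_apply, Pi.neg_apply]
      linarith) s x
    have h3 := hS.neg_realValue_neg_le hκ hun.1 s x
    simp only at hlt1 hlt2
    linarith
  suffices h : realValue S t f x ≤ f x + t * a by linarith
  -- The index `k` measures closeness of `u n` to `f` as functions; the further index `j` makes the
  -- values at the point `x` differ by at most `δ`.
  refine hS.realValue_le_of_approx hκ hcont hbdd hM hf fun k δ hδ => ?_
  obtain ⟨j, hj⟩ := ((tendsto_weightCutoff (κ := κ) M x).eventually_lt_const hδ).exists
  obtain ⟨n, hn1, hn2, hn3, hn4⟩ := (hB.and (hu.and ((huf k).and (huf j)))).exists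
  refine ⟨u n, hn2.1, hn3, ?_⟩
  have := (abs_le.1 (hn4 x)).2
  linarith

/-- A lower bound on the `Γ`-derivative of an average of translates of `f` yields nearby lower
bounds on the difference quotients of `f`. -/
theorem eventually_exists_lt_of_smear (hS : IsConvexMonotoneFamily κ S) (hκ : ∀ x, 0 < κ x)
    (hcont : Continuous κ) {f G : 𝔼 → ℝ} (hf : f ∈ upperLipschitzSet κ S) {μ : Measure 𝔼}
    [IsProbabilityMeasure μ] {ρ : ℝ} (hμ : ∀ᵐ y ∂μ, y ∈ Metric.closedBall (0 : 𝔼) ρ)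
    (hμf : smear μ f ∈ Ckappa κ)
    (hG : IsGammaDeriv κ S (smear μ f) (fun x => (G x : EReal))) {t₀ : ℝ≥0} (ht₀ : 0 < t₀) {e : ℝ}
    (hle : ∀ t ≤ t₀, ∀ x, realValue S t (smear μ f) x ≤
      smear μ (realValue S t f) x + e * t / κ x) {z : 𝔼} {a : ℝ} (ha : a + e / κ z < G z)
    {r : ℝ} (hr : ρ < r) {h : ℕ → ℝ≥0} (hpos : ∀ n, 0 < h n) (hlim : Tendsto h atTop (𝓝 0)) :
    ∀ᶠ k in atTop, ∃ y, dist y z < r ∧ a < (realValue S (h k) f y - f y) / h k := by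
  obtain ⟨x, hx, hxG⟩ := (hG.2 h hpos hlim z).2
  simp_rw [hS.diffQuotient_eq hκ hμf] at hxG
  have hxG := EReal.tendsto_coe.1 hxG
  have hκz : Tendsto (fun k => a + e / κ (x k)) atTop (𝓝 (a + e / κ z)) :=
    (tendsto_const_nhds.div ((hcont.tendsto z).comp hx) (hκ z).ne').const_add a
  have hxr : ∀ᶠ k in atTop, dist (x k) z < r - ρ :=
    (Metric.tendsto_nhds.1 hx) _ (by linarith)
  filter_upwards [hκz.eventually_lt hxG ha, hlim.eventually_le_const ht₀, hxr] with k hk hkt hkr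
  have hk0 : (0 : ℝ) < h k := hpos k
  have hU := (hS.realValue_mem hκ hf (h k)).1
  -- Jensen's inequality bounds the average of `S (h k) f - f` from below by the increment of `smear
  -- μ f`, up to the defect `e`; an average above `h k * a` forces some value above it.
  have h1 : (h k : ℝ) * a < smear μ (realValue S (h k) f - f) (x k) := by
    have h2 : smear μ (realValue S (h k) f - f) (x k) =
        smear μ (realValue S (h k) f) (x k) - smear μ f (x k) :=
      integral_sub (integrable_translate hμ hU _) (integrable_translate hμ hf.1.1 _)
    have h3 := hle _ hkt (x k)
    rw [lt_div_iff₀ hk0] at hk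
    have h4 : e * h k / κ (x k) = e / κ (x k) * h k := by ring
    rw [h2]
    linarith
  obtain ⟨y, hy, hlt⟩ := exists_lt_of_lt_smear hμ (hU.sub hf.1.1) h1
  refine ⟨x k - y, ?_, ?_⟩
  · have h5 : dist (x k - y) (x k) ≤ ρ := by
      rw [dist_eq_norm, sub_sub_cancel_left, norm_neg]
      exact mem_closedBall_zero_iff.1 hy
    linarith [dist_triangle (x k - y) (x k) z]
  · rw [lt_div_iff₀ hk0, mul_comm]
    exact hlt

/-- `v` is the `Γ`-derivative if it bounds the difference quotients from above locally uniformly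
and from below at nearby points. -/
theorem isGammaDeriv_of_bounds (hS : IsConvexMonotoneFamily κ S) (hκ : ∀ x, 0 < κ x) {f : 𝔼 → ℝ}
    (hf : f ∈ Ckappa κ) {v : 𝔼 → EReal} (hv : v ∈ Ukappa κ)
    (hupper : ∀ x, ∀ a : ℝ, v x < a → ∃ s₀ : ℝ≥0, 0 < s₀ ∧ ∀ᶠ y in 𝓝 x, ∀ t ≤ s₀,
      realValue S t f y - f y ≤ t * a)
    (hlower : ∀ x, ∀ a : ℝ, a < v x → ∀ r > 0, ∀ h : ℕ → ℝ≥0, (∀ n, 0 < h n) →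
      Tendsto h atTop (𝓝 0) →
      ∀ᶠ k in atTop, ∃ y, dist y x < r ∧ a < (realValue S (h k) f y - f y) / h k) :
    IsGammaDeriv κ S f v := by
  refine ⟨hv, fun h hpos hlim x => ?_⟩
  have hq : ∀ k y, diffQuotient S f (h k) y = (((realValue S (h k) f y - f y) / h k : ℝ) : EReal) :=
    fun k y => hS.diffQuotient_eq hκ hf (h k) y
  have up : ∀ b : EReal, v x < b → ∃ U ∈ 𝓝 x, ∀ᶠ k in atTop, ∀ y ∈ U,
      diffQuotient S f (h k) y < b := by
    intro b hb
    obtain ⟨a, hva, hab⟩ := EReal.lt_iff_exists_real_btwn.1 hb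
    obtain ⟨s₀, hs₀, hs⟩ := hupper x a hva
    refine ⟨_, hs, ?_⟩
    filter_upwards [hlim.eventually_le_const hs₀] with k hk y hy
    have hk0 : (0 : ℝ) < h k := hpos k
    refine lt_of_le_of_lt ?_ hab
    rw [hq, EReal.coe_le_coe_iff, div_le_iff₀ hk0, mul_comm]
    exact hy _ hk
  refine ⟨fun y hy => ?_, ?_⟩
  · refine le_of_forall_gt_imp_ge_of_dense fun b hb => ?_
    obtain ⟨U, hU, hUb⟩ := up b hb
    refine limsup_le_of_le (h := ?_)
    filter_upwards [hUb, hy hU] with k hk hyk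
    exact (hk _ hyk).le
  -- At `⊥` there is nothing to approach from below, and the constant sequence already recovers the
  -- limit.
  by_cases hbot : v x = ⊥
  · refine ⟨fun _ => x, tendsto_const_nhds, tendsto_order.2 ⟨fun a ha => ?_, fun b hb => ?_⟩⟩
    · simp [hbot] at ha
    · obtain ⟨U, hU, hUb⟩ := up b hb
      exact hUb.mono fun k hk => hk x (mem_of_mem_nhds hU)
  · obtain ⟨y, hy⟩ := exists_seq_tendsto_of_eventually (F := 𝓝 (x, v x))
      (Φ := fun k y => (y, diffQuotient S f (h k) y)) x fun V hV => by
        rw [nhds_prod_eq, mem_prod_iff] at hV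
        obtain ⟨U, hU, W, hW, hUW⟩ := hV
        obtain ⟨a, b, ⟨hav, hvb⟩, hab⟩ := (mem_nhds_iff_exists_Ioo_subset'
          ⟨⊥, bot_lt_iff_ne_bot.2 hbot⟩ ⟨⊤, lt_top_iff_ne_top.2 (hv.2.1 x)⟩).1 hW
        obtain ⟨U', hU', hUb⟩ := up b hvb
        obtain ⟨a₁, haa₁, ha₁⟩ := EReal.lt_iff_exists_real_btwn.1 hav
        obtain ⟨r, hr, hrU⟩ := Metric.mem_nhds_iff.1 (inter_mem hU hU')
        -- The point supplied by the lower bound also lies in the neighbourhood on which the upper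
        -- bound is uniform.
        filter_upwards [hUb, hlower x a₁ ha₁ r hr h hpos hlim] with k hk ⟨y, hyr, hy⟩
        have hyU := hrU hyr
        refine ⟨y, hUW ⟨hyU.1, hab ⟨haa₁.trans ?_, hk y hyU.2⟩⟩⟩
        simp only [hq]
        exact EReal.coe_lt_coe_iff.2 hy
    exact ⟨y, hy.fst_nhds, hy.snd_nhds⟩

end IsConvexMonotoneFamily

theorem mem_Ukappa_of_le_div (hκ : ∀ x, 0 < κ x) {v : 𝔼 → EReal} (hv : UpperSemicontinuous v)
    {C : ℝ} (hC : 0 ≤ C) (h : ∀ x, v x ≤ ((C / κ x : ℝ) : EReal)) : v ∈ Ukappa κ := by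
  refine ⟨hv, fun x => ((h x).trans_lt (EReal.coe_lt_top _)).ne, ?_⟩
  refine lt_of_le_of_lt (iSup_le fun x => ?_) (ENNReal.ofReal_lt_top (r := C))
  have h1 : max (v x) 0 ≤ ((C / κ x : ℝ) : EReal) :=
    max_le (h x) (EReal.coe_nonneg.2 (div_nonneg hC (hκ x).le))
  have h2 : 0 ≤ max (v x) 0 := le_max_right _ _
  beta_reduce
  generalize max (v x) 0 = m at h1 h2 ⊢
  induction m with
  | bot => simp at h2
  | top => simp at h1
  | coe m =>
    rw [EReal.coe_le_coe_iff] at h1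
    rw [EReal.coe_nonneg] at h2
    rw [EReal.abs_def, abs_of_nonneg h2, ← ENNReal.ofReal_mul h2]
    exact ENNReal.ofReal_le_ofReal ((le_div_iff₀ (hκ x)).1 h1)

end Bounds

/-! ### Mollified semigroup estimates -/

section Main

variable {d : ℕ} {κ : EuclideanSpace ℝ (Fin d) → ℝ}
  {S : ℝ≥0 → (EuclideanSpace ℝ (Fin d) → ℝ) → EuclideanSpace ℝ (Fin d) → EReal}
  {η : EuclideanSpace ℝ (Fin d) → ℝ}

local notation "𝔼" => EuclideanSpace ℝ (Fin d)

theorem smear_mollifierMeasure_le (hη : ContDiff ℝ ∞ η) (hη0 : ∀ x, 0 ≤ η x)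
    (hηs : tsupport η ⊆ Metric.closedBall 0 1) (hηi : ∫ x, η x = 1) {n : ℕ} (hn : 1 ≤ n)
    {g : 𝔼 → ℝ} (hg : LocallyIntegrable g volume) {x : 𝔼} {a : ℝ}
    (h : ∀ᵐ z, z ∈ Metric.closedBall x (1 / n) → g z ≤ a) :
    smear (mollifierMeasure η n) g x ≤ a := by
  have := isProbabilityMeasure_mollifierMeasure hη hη0 hηs hηi hn
  have h1 : ∀ᵐ y ∂mollifierMeasure η n, x - y ∈ Metric.closedBall x (1 / n) → g (x - y) ≤ a :=
    (withDensity_absolutelyContinuous _ _).ae_le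
      ((quasiMeasurePreserving_sub_left volume x).ae h)
  have h2 := integral_mono_ae (integrable_smear hη hη0 hηs hn hg x) (integrable_const a) (by
    filter_upwards [h1, ae_mollifierMeasure hη hηs hn] with y hy hyb
    refine hy ?_
    rw [mem_closedBall_iff_norm, sub_sub_cancel_left, norm_neg]
    exact mem_closedBall_zero_iff.1 hyb)
  simpa [smear] using h2

theorem eventually_one_div_le {r : ℝ} (hr : 0 < r) :
    ∀ᶠ n : ℕ in atTop, 1 ≤ n ∧ 1 / (n : ℝ) ≤ r :=
  (eventually_ge_atTop 1).and (tendsto_one_div_atTop_nhds_zero_nat.eventually_le_const hr)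

/-- The mollified semigroup dominates the semigroup applied to mollifications, up to the defect of
translation invariance. -/
theorem IsConvexMonotoneFamily.realValue_mollifier_le (hS : IsConvexMonotoneFamily κ S)
    (hκ : ∀ x, 0 < κ x) (hcont : Continuous κ) (hbdd : ∃ C : ℝ, ∀ x, κ x ≤ C) {c : ℝ}
    (hc : ∀ x y : 𝔼, ‖y‖ ≤ 1 → κ x / κ (x - y) ≤ c) (hη : ContDiff ℝ ∞ η) (hη0 : ∀ x, 0 ≤ η x)
    (hηs : tsupport η ⊆ Metric.closedBall 0 1) (hηi : ∫ x, η x = 1) {f : 𝔼 → ℝ}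
    (hf : f ∈ upperLipschitzSet κ S)
    (htrans : ∀ ε : ℝ, 0 < ε → ∃ δ : ℝ, 0 < δ ∧ ∃ t₀ : ℝ≥0, 0 < t₀ ∧
      ∀ t ≤ t₀, ∀ x : 𝔼, ‖x‖ ≤ δ →
        kappaNorm κ (fun y => S t (fun z => f (x + z)) y - S t f (x + y)) ≤ ENNReal.ofReal (ε * t))
    (hmem : ∀ n : ℕ, 1 ≤ n → smear (mollifierMeasure η n) f ∈ Ckappa κ) {ε : ℝ} (hε : 0 < ε) :
    ∃ t₀ : ℝ≥0, 0 < t₀ ∧ ∀ᶠ n in atTop, ∀ t ≤ t₀, ∀ x,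
      realValue S t (smear (mollifierMeasure η n) f) x ≤
        smear (mollifierMeasure η n) (realValue S t f) x + ε * t / κ x := by
  obtain ⟨δ, hδ, t₀, ht₀, h⟩ := htrans ε hε
  refine ⟨t₀, ht₀, ?_⟩
  filter_upwards [eventually_one_div_le (lt_min hδ one_pos)] with n ⟨hn, hnδ⟩ t ht x
  have := isProbabilityMeasure_mollifierMeasure hη hη0 hηs hηi hn
  have hn1 := hnδ.trans (min_le_right _ _)
  refine hS.realValue_smear_le hκ hcont hbdd hc (by positivity) hn1
    (ae_mollifierMeasure hη hηs hn) hf.1 (hmem n hn) (hS.realValue_mem hκ hf t).1 fun y hy => ?_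
  rw [mem_closedBall_zero_iff] at hy
  refine hS.realValue_translate_le hκ hc hf.1 (by positivity) (hy.trans hn1) (h t ht (-y) ?_) x
  rw [norm_neg]
  exact hy.trans (hnδ.trans (min_le_left _ _))

/-- Mollifications are upper Lipschitz with a common constant. -/
theorem IsConvexMonotoneFamily.exists_realValue_mollifier_le_add
    (hS : IsConvexMonotoneFamily κ S)
    (hκ : ∀ x, 0 < κ x) {c : ℝ} (hc : ∀ x y : 𝔼, ‖y‖ ≤ 1 → κ x / κ (x - y) ≤ c)
    (hη : ContDiff ℝ ∞ η) (hη0 : ∀ x, 0 ≤ η x)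
    (hηs : tsupport η ⊆ Metric.closedBall 0 1) (hηi : ∫ x, η x = 1) {f : 𝔼 → ℝ}
    (hf : f ∈ upperLipschitzSet κ S) {t₀ : ℝ≥0} (ht₀ : 0 < t₀)
    (hle : ∀ᶠ n in atTop, ∀ t ≤ t₀, ∀ x,
      realValue S t (smear (mollifierMeasure η n) f) x ≤
        smear (mollifierMeasure η n) (realValue S t f) x + 1 * t / κ x) :
    ∃ C : ℝ, 0 ≤ C ∧ ∃ h₁ : ℝ≥0, 0 < h₁ ∧ ∀ᶠ n in atTop, ∀ h ≤ h₁, ∀ x,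
      realValue S h (smear (mollifierMeasure η n) f) x ≤
        smear (mollifierMeasure η n) f x + h * (C / κ x) := by
  obtain ⟨h₀, hh₀, L, hL, hlip⟩ := hS.exists_realValue_le hκ hf
  have hc0 : 0 ≤ c := (div_pos (hκ 0) (hκ _)).le.trans (hc 0 0 (by simp))
  -- `L` is the upper Lipschitz constant of `f`, `c` the cost of translating the weight, and `1` the
  -- translation defect.
  refine ⟨c * L + 1, by positivity, min h₀ t₀, lt_min hh₀ ht₀, ?_⟩
  filter_upwards [hle, eventually_one_div_le one_pos] with n hn ⟨hn1, hn1'⟩ h hh x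
  have := isProbabilityMeasure_mollifierMeasure hη hη0 hηs hηi hn1
  have h1 := smear_le_smear_add (ae_mollifierMeasure hη hηs hn1)
    (hS.realValue_mem hκ hf h).1 hf.1.1 (x := x) (b := c * (L * h) / κ x) fun y hy => by
      have h2 := hlip h (hh.trans (min_le_left _ _)) (x - y)
      have h3 := div_weight_translate_le hκ hc (M := L * h) (by positivity) x
        ((mem_closedBall_zero_iff.1 hy).trans hn1')
      linarith
  have h4 := hn h (hh.trans (min_le_right _ _)) x
  have h5 : (h : ℝ) * ((c * L + 1) / κ x) = c * (L * h) / κ x + 1 * h / κ x := by ring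
  linarith

end Main

end GammaSemigroup

end

/-! ### The main theorem -/

open GammaSemigroup in
theorem theorem3p7 {d : ℕ}
    (κ : EuclideanSpace ℝ (Fin d) → ℝ) (hκ_cont : Continuous κ) (hκ_pos : ∀ x, 0 < κ x)
    (hκ_bdd : ∃ C : ℝ, ∀ x, κ x ≤ C)
    (hκ_shift : ∃ c : ℝ, ∀ x y : EuclideanSpace ℝ (Fin d), ‖y‖ ≤ 1 → κ x / κ (x - y) ≤ c)
    (S : ℝ≥0 → (EuclideanSpace ℝ (Fin d) → ℝ) → EuclideanSpace ℝ (Fin d) → EReal)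
    (hS : GammaSemigroup.IsConvexMonotoneFamily κ S)
    (η : EuclideanSpace ℝ (Fin d) → ℝ) (hη_smooth : ContDiff ℝ ∞ η) (hη_nonneg : ∀ x, 0 ≤ η x)
    (hη_supp : tsupport η ⊆ Metric.closedBall 0 1) (hη_int : ∫ x, η x = 1)
    (I : Set (Fin d → ℕ)) (H : (I → ℝ) → ℝ) (hH : ConvexOn ℝ Set.univ H)
    (hH_cont : I.Infinite → Continuous H)
    (f : EuclideanSpace ℝ (Fin d) → ℝ) (hf : f ∈ GammaSemigroup.upperLipschitzSet κ S)
    (hf_trans : ∀ ε : ℝ, 0 < ε → ∃ δ : ℝ, 0 < δ ∧ ∃ t₀ : ℝ≥0, 0 < t₀ ∧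
      ∀ t ≤ t₀, ∀ x : EuclideanSpace ℝ (Fin d), ‖x‖ ≤ δ →
        GammaSemigroup.kappaNorm κ (fun y => S t (fun z => f (x + z)) y - S t f (x + y))
          ≤ ENNReal.ofReal (ε * t))
    (F : I → EuclideanSpace ℝ (Fin d) → ℝ)
    (hF : ∀ α : I, GammaSemigroup.HasWeakDeriv (α : Fin d → ℕ) f (F α))
    (hHF : LocallyIntegrable (fun x => H (fun α => F α x)) volume)
    (hfn_dom : ∀ n : ℕ, 1 ≤ n →
      GammaSemigroup.mollify η f n ∈ GammaSemigroup.gammaDomain κ S)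
    (hfn_gen : ∀ n : ℕ, 1 ≤ n → ∀ x,
      GammaSemigroup.gammaGenerator κ S (GammaSemigroup.mollify η f n) x =
        ((H (fun α : I => GammaSemigroup.multiDeriv (α : Fin d → ℕ)
          (GammaSemigroup.mollify η f n) x) : ℝ) : EReal)) :
    f ∈ GammaSemigroup.gammaDomain κ S ∧
      ∀ x, GammaSemigroup.gammaGenerator κ S f x =
        GammaSemigroup.uscHull (fun x => H (fun α => F α x)) x := by
  set g : EuclideanSpace ℝ (Fin d) → ℝ := fun x => H (fun α => F α x)
  obtain ⟨c, hc⟩ := hκ_shift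
  have hHc : Continuous H := continuous_of_convexOn_univ hH fun h =>
    hH_cont (Set.infinite_coe_iff.1 h)
  have hfc : f ∈ Ckappa κ := hf.1
  have hfl : LocallyIntegrable f volume := hfc.1.locallyIntegrable
  set μ : ℕ → Measure (EuclideanSpace ℝ (Fin d)) := mollifierMeasure η
  have hμp : ∀ n, 1 ≤ n → IsProbabilityMeasure (μ n) := fun n hn =>
    isProbabilityMeasure_mollifierMeasure hη_smooth hη_nonneg hη_supp hη_int hn
  have hμb : ∀ n : ℕ, 1 ≤ n → ∀ᵐ y ∂μ n,
      y ∈ Metric.closedBall (0 : EuclideanSpace ℝ (Fin d)) (1 / n) := fun n hn =>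
    ae_mollifierMeasure hη_smooth hη_supp hn
  simp only [mollify_eq_smear hη_smooth hη_nonneg] at hfn_dom hfn_gen
  set G : ℕ → EuclideanSpace ℝ (Fin d) → ℝ := fun n x => H fun α => smear (μ n) (F α) x
  have hG : ∀ n, 1 ≤ n → IsGammaDeriv κ S (smear (μ n) f) (fun x => (G n x : EReal)) := by
    intro n hn
    obtain ⟨u, hu⟩ := (hfn_dom n hn).2
    have : u = fun x => (G n x : EReal) := by
      rw [← hu.gammaGenerator_eq]
      funext x
      rw [hfn_gen n hn x]
      simp_rw [multiDeriv_smear hη_smooth hη_nonneg hη_supp hn hfl (hF _)]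
      rfl
    rwa [← this]
  -- There are countably many multi-indices, so almost every point is good for all of them;
  -- continuity of `H` in the product topology then suffices.
  have hGlim : ∀ᵐ x, Tendsto (fun n => G n x) atTop (𝓝 (g x)) := by
    have h := ae_all_iff.2 fun α : I =>
      ae_tendsto_smear hη_smooth hη_nonneg hη_supp hη_int (hF α).1
    filter_upwards [h] with x hx
    exact (hHc.tendsto _).comp (tendsto_pi_nhds.2 hx)
  have hGg : ∀ n, 1 ≤ n → ∀ x, G n x ≤ smear (μ n) g x := fun n hn x => by
    have := hμp n hn
    exact jensen_pi hH hHc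
      (fun α => integrable_smear hη_smooth hη_nonneg hη_supp hn (hF α).1 x)
      (integrable_smear hη_smooth hη_nonneg hη_supp hn hHF x)
  have hmem : ∀ n : ℕ, 1 ≤ n → smear (μ n) f ∈ Ckappa κ := fun n hn => (hfn_dom n hn).1.1
  have hmol : ∀ {ε : ℝ}, 0 < ε → _ := fun {ε} hε =>
    hS.realValue_mollifier_le hκ_pos hκ_cont hκ_bdd hc hη_smooth hη_nonneg hη_supp hη_int hf
      hf_trans hmem hε
  obtain ⟨t₁, ht₁, hle₁⟩ := hmol one_pos
  obtain ⟨C, hC, h₁, hh₁, hlip⟩ := hS.exists_realValue_mollifier_le_add hκ_pos hc hη_smooth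
    hη_nonneg hη_supp hη_int hf ht₁ hle₁
  have hbc : Continuous fun x => C / κ x :=
    continuous_const.div hκ_cont fun x => (hκ_pos x).ne'
  have hGC : ∀ᶠ n in atTop, ∀ x, G n x ≤ C / κ x := by
    filter_upwards [hlip, eventually_ge_atTop 1] with n hn hn1
    exact hS.le_of_isGammaDeriv hκ_pos (hmem n hn1) (hG n hn1) hbc hh₁ hn
  -- The common Lipschitz bound of the mollifications passes to `g` and then to its hull, which
  -- places the hull in `U_κ`.
  have hgC : ∀ᵐ x, g x ≤ C / κ x := by
    filter_upwards [hGlim] with x hx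
    exact le_of_tendsto hx (hGC.mono fun n hn => hn x)
  obtain ⟨M, hM, happ⟩ := abs_smear_sub_le_weightCutoff hκ_pos hc hfc
  have hU : uscHull g ∈ Ukappa κ := mem_Ukappa_of_le_div hκ_pos (upperSemicontinuous_uscHull g) hC
    (uscHull_le_of_ae_le hHF hbc hgC)
  have hderiv : IsGammaDeriv κ S f (uscHull g) := by
    refine hS.isGammaDeriv_of_bounds hκ_pos hfc hU (fun x a ha => ?_)
      (fun x a ha r hr h hpos hlim => ?_)
    · obtain ⟨a', hxa', ha'⟩ := EReal.lt_iff_exists_real_btwn.1 ha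
      obtain ⟨r, hr, hball⟩ := Metric.mem_nhds_iff.1 (upperSemicontinuous_uscHull g x a' hxa')
      refine hS.exists_realValue_sub_le_of_approx hκ_pos hκ_cont hκ_bdd hfc
        ((eventually_ge_atTop 1).mono fun n hn => (hfn_dom n hn).1)
        ((eventually_ge_atTop 1).mono hG) hM (fun m => ?_) hC hh₁ hlip (x₀ := x) (half_pos hr)
        (EReal.coe_lt_coe_iff.1 ha') ?_
      · obtain ⟨ρ₀, hρ₀, hρ⟩ := happ m
        filter_upwards [eventually_one_div_le hρ₀] with n ⟨hn1, hn⟩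
        exact hρ _ hn (μ n) (hμp n hn1) (hμb n hn1)
      -- Mollifying with radius at most `r / 4` at points within `r / 2` of `x` only uses values of
      -- `g` in the ball where the hull is below `a'`.
      · filter_upwards [eventually_one_div_le (half_pos (half_pos hr))] with n ⟨hn1, hn⟩ y hy
        refine (hGg n hn1 y).trans (smear_mollifierMeasure_le hη_smooth hη_nonneg hη_supp hη_int
          hn1 hHF ?_)
        filter_upwards [ae_le_uscHull hHF] with z hz hzy
        have hzx : z ∈ Metric.ball x r := by
          rw [Metric.mem_closedBall] at hy hzy
          rw [Metric.mem_ball]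
          linarith [dist_triangle z y x]
        exact EReal.coe_le_coe_iff.1 (hz.trans (le_of_lt (hball hzx)))
    · obtain ⟨a₁, ha₁, ha₁'⟩ := EReal.lt_iff_exists_real_btwn.1 ha
      rw [EReal.coe_lt_coe_iff] at ha₁
      -- The exceptional set is not null, so it meets the full-measure set where `G n z` converges
      -- to `g z`.
      have hfreq : ∃ᶠ z in ae volume, ¬(z ∈ Metric.ball x (r / 2) → g z ≤ a₁) := fun hcon =>
        absurd ha₁' (not_lt.2 (uscHull_le_of_ae_le_on hHF Metric.isOpen_ball
          (hcon.mono fun z hz => not_not.1 hz) (Metric.mem_ball_self (half_pos hr))))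
      obtain ⟨z, hz, hzlim⟩ := (hfreq.and_eventually hGlim).exists
      push Not at hz
      obtain ⟨hzx, hza⟩ := hz
      -- Chosen so that `a + ε / κ z = a₁`, which lies below `G n z` for large `n`.
      have hε : 0 < (a₁ - a) * κ z := mul_pos (sub_pos.2 ha₁) (hκ_pos z)
      obtain ⟨t₀, ht₀, hle⟩ := hmol hε
      obtain ⟨n, hn, hna, hn1, hnr⟩ := (hle.and ((hzlim.eventually_const_lt hza).and
        (eventually_one_div_le (half_pos (half_pos hr))))).exists
      have := hμp n hn1
      refine (hS.eventually_exists_lt_of_smear hκ_pos hκ_cont hf (hμb n hn1) (hmem n hn1)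
        (hG n hn1) ht₀ hn (z := z) (a := a) (r := r / 2) ?_ (by linarith) hpos hlim).mono ?_
      · rw [mul_div_assoc, div_self (hκ_pos z).ne']
        linarith
      · rintro k ⟨y, hy, hlt⟩
        rw [Metric.mem_ball] at hzx
        exact ⟨y, by linarith [dist_triangle y z x], hlt⟩
  exact ⟨⟨hf, _, hderiv⟩, fun x => by rw [hderiv.gammaGenerator_eq]⟩
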